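/- Let $\mathcal A$ be a unital exact $C^*$-algebra, $\theta:\mathcal A\to\mathcal A$ a unital completely positive (u.c.p.) map, $a\in\mathcal A$ self-adjoint, and $\pi:\mathcal A\to\mathcal B(\mathcal H)$ a faithful unital $*$-representation. For a finite set $\Omega\subset\mathcal A$, $\delta>0$ and $n\in\mathbb N$ put $\Omega^{(n)}=\Omega\cup\theta(\Omega)\cup\dots\cup\theta^{n-1}(\Omega)$ and $a^{(n)}=\sum_{j=0}^{n-1}\theta^j(a)$. Let $\mathrm{CPA}(\pi,\Omega^{(n)},\delta)$ be the set of triples $(\phi,\psi,\mathcal B)$ where $\mathcal B$ is a finite-dimensional $C^*$-algebra and $\phi:\mathcal A\to\mathcal B$, $\psi:\mathcal B\to\mathcal B(\mathcal H)$ are u.c.p. maps with $\|\psi(\phi(x))-\pi(x)\|<\delta$ for all $x\in\Omega^{(n)}$. Put $$Z_{\theta,n}(\pi,a,\Omega,\delta)=\inf\{\mathrm{Tr}\,e^{\phi(a^{(n)})}:(\phi,\psi,\mathcal B)\in\mathrm{CPA}(\pi,\Omega^{(n)},\delta)\},$$ where $\mathrm{Tr}$ is the trace on $\mathcal B$ with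 value $1$ on every minimal projection, and define the pressure $$P_\theta(\pi,a)=\sup_{\Omega}\,\sup_{\delta>0}\,\limsup_{n\to\infty}\frac1n\log Z_{\theta,n}(\pi,a,\Omega,\delta)\in[-\infty,\infty].$$ This number does not depend on the choice of $\pi$ and is denoted $P_\theta(a)$. **Proposition 3.5.** Let $\mathcal A_1,\mathcal A_2$ be unital exact $C^*$-algebras, let $\theta_1:\mathcal A_1\to\mathcal A_1$ and $\theta_2:\mathcal A_2\to\mathcal A_2$ be u.c.p. maps, and let $a_1\in\mathcal A_1$, $a_2\in\mathcal A_2$ be self-adjoint. Then the map $\theta_1\otimes\theta_2$ on the algebraic tensor product has a unique completely positive extension $\theta:\mathcal A_1\otimes_{\min}\mathcal A_2\to\mathcal A_1\otimes_{\min}\mathcal A_2$ to the minimal tensor product; this extension is unital, and $$P_\theta(a_1\otimes1+1\otimes a_2)\le P_{\theta_1}(a_1)+P_{\theta_2}(a_2).$$ The inequality holds for every choice of the faithful unital representations of $\mathcal A_1$, $\mathcal A_2$ and $\mathcal A_1\otimes_{\min}\mathcal A_2$ through which the three pressures are computed. -/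

import Mathlib

open scoped TensorProduct ComplexOrder ENNReal
open Filter

universe u

namespace NCPressure

/-! ### The minimal (spatial) tensor product -/

section MinTensor

variable {A₁ A₂ H₁ H₂ : Type*} [CStarAlgebra A₁] [CStarAlgebra A₂]
  [NormedAddCommGroup H₁] [InnerProductSpace ℂ H₁] [CompleteSpace H₁]
  [NormedAddCommGroup H₂] [InnerProductSpace ℂ H₂] [CompleteSpace H₂]

/-- The Hilbert space tensor product, i.e. the completion of the algebraic tensor product for the
inner product with `⟪a ⊗ b, c ⊗ d⟫ = ⟪a, c⟫ * ⟪b, d⟫`. -/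
def HilbertTensor (H₁ H₂ : Type*)
    [NormedAddCommGroup H₁] [InnerProductSpace ℂ H₁]
    [NormedAddCommGroup H₂] [InnerProductSpace ℂ H₂] : Type _ :=
  UniformSpace.Completion (H₁ ⊗[ℂ] H₂)

noncomputable instance : NormedAddCommGroup (HilbertTensor H₁ H₂) :=
  inferInstanceAs (NormedAddCommGroup (UniformSpace.Completion (H₁ ⊗[ℂ] H₂)))

noncomputable instance : InnerProductSpace ℂ (HilbertTensor H₁ H₂) :=
  inferInstanceAs (InnerProductSpace ℂ (UniformSpace.Completion (H₁ ⊗[ℂ] H₂)))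

instance : CompleteSpace (HilbertTensor H₁ H₂) :=
  inferInstanceAs (CompleteSpace (UniformSpace.Completion (H₁ ⊗[ℂ] H₂)))

/-- The bounded operator `S ⊗ T` on the Hilbert space tensor product: the continuous extension of
the algebraic tensor product of `S` and `T`. -/
noncomputable def tensorOp (S : H₁ →L[ℂ] H₁) (T : H₂ →L[ℂ] H₂) :
    HilbertTensor H₁ H₂ →L[ℂ] HilbertTensor H₁ H₂ :=
  ContinuousLinearMap.completion (TensorProduct.mapL S T)

/-- The C⋆-subalgebra of the bounded operators on the Hilbert space tensor product which is
generated by the operators `π₁ x ⊗ π₂ y`. -/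
noncomputable def minTensorSubalgebra
    (π₁ : A₁ →⋆ₐ[ℂ] (H₁ →L[ℂ] H₁)) (π₂ : A₂ →⋆ₐ[ℂ] (H₂ →L[ℂ] H₂)) :
    StarSubalgebra ℂ (HilbertTensor H₁ H₂ →L[ℂ] HilbertTensor H₁ H₂) :=
  (StarAlgebra.adjoin ℂ {T | ∃ x y, T = tensorOp (π₁ x) (π₂ y)}).topologicalClosure

/-- The minimal tensor product `A₁ ⊗ A₂` of two unital C⋆-algebras, realized spatially through
(faithful) unital representations `π₁` and `π₂`. -/
def MinTensor (π₁ : A₁ →⋆ₐ[ℂ] (H₁ →L[ℂ] H₁)) (π₂ : A₂ →⋆ₐ[ℂ] (H₂ →L[ℂ] H₂)) : Type _ :=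
  minTensorSubalgebra π₁ π₂

namespace MinTensor

variable (π₁ : A₁ →⋆ₐ[ℂ] (H₁ →L[ℂ] H₁)) (π₂ : A₂ →⋆ₐ[ℂ] (H₂ →L[ℂ] H₂))

instance : IsClosed (minTensorSubalgebra π₁ π₂ :
    Set (HilbertTensor H₁ H₂ →L[ℂ] HilbertTensor H₁ H₂)) :=
  StarSubalgebra.isClosed_topologicalClosure _

noncomputable instance : CStarAlgebra (MinTensor π₁ π₂) :=
  inferInstanceAs (CStarAlgebra (minTensorSubalgebra π₁ π₂))

noncomputable instance : PartialOrder (MinTensor π₁ π₂) := CStarAlgebra.spectralOrder _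

instance : StarOrderedRing (MinTensor π₁ π₂) := CStarAlgebra.spectralOrderedRing _

/-- The inclusion of the minimal tensor product into the bounded operators. -/
noncomputable def incl :
    MinTensor π₁ π₂ →⋆ₐ[ℂ] (HilbertTensor H₁ H₂ →L[ℂ] HilbertTensor H₁ H₂) :=
  (minTensorSubalgebra π₁ π₂).subtype

/-- The elementary tensor `x ⊗ y` in the minimal tensor product. -/
noncomputable def tmul (x : A₁) (y : A₂) : MinTensor π₁ π₂ :=
  ⟨tensorOp (π₁ x) (π₂ y), StarSubalgebra.le_topologicalClosure _
    (StarAlgebra.subset_adjoin ℂ _ ⟨x, y, rfl⟩)⟩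

end MinTensor

end MinTensor

/-! ### Exactness -/

/-- A unital C⋆-algebra `A` is exact if tensoring minimally with `A` preserves short exact
sequences `0 → ker q → B → C → 0` of C⋆-algebras: the kernel of `id ⊗ q : A ⊗ B → A ⊗ C` is
`A ⊗ ker q`, the closed linear span of the tensors `a ⊗ j` with `q j = 0`.
(Exactness at the other two places is automatic.  By adjoining a unit to `B` it suffices to consider
unital `B`; then `C`, as a quotient of `B`, is unital too.) -/
def IsExact (A : Type u) [CStarAlgebra A] : Prop :=
  ∀ (B C H K L : Type u) [CStarAlgebra B] [CStarAlgebra C]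
    [NormedAddCommGroup H] [InnerProductSpace ℂ H] [CompleteSpace H]
    [NormedAddCommGroup K] [InnerProductSpace ℂ K] [CompleteSpace K]
    [NormedAddCommGroup L] [InnerProductSpace ℂ L] [CompleteSpace L]
    (π : A →⋆ₐ[ℂ] (H →L[ℂ] H)) (σ : B →⋆ₐ[ℂ] (K →L[ℂ] K)) (τ : C →⋆ₐ[ℂ] (L →L[ℂ] L))
    (q : B →⋆ₐ[ℂ] C) (Q : MinTensor π σ →⋆ₐ[ℂ] MinTensor π τ),
    Function.Injective π → Function.Injective σ → Function.Injective τ → Function.Surjective q →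
    (∀ a b, Q (MinTensor.tmul π σ a b) = MinTensor.tmul π τ a (q b)) →
    {x | Q x = 0} = closure (Submodule.span ℂ {x | ∃ a b, q b = 0 ∧ x = MinTensor.tmul π σ a b} :
      Set (MinTensor π σ))

/-! ### Finite-dimensional C⋆-algebras -/

/-- The data of a finite-dimensional C⋆-algebra: up to isomorphism these are exactly the finite
direct sums of full matrix algebras over `ℂ`. `ι` indexes the summands, and the `i`-th summand
consists of the matrices indexed by `n i`. -/
structure FinDimData where
  ι : Type
  n : ι → Type
  [fintypeι : Fintype ι]
  [fintypen : ∀ i, Fintype (n i)]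
  [deceqn : ∀ i, DecidableEq (n i)]

attribute [instance] FinDimData.fintypeι FinDimData.fintypen FinDimData.deceqn

namespace FinDimData

/-- The finite-dimensional C⋆-algebra `⨁ i, M_{n i}(ℂ)`, with its C⋆-norm. -/
abbrev Alg (B : FinDimData) : Type := ∀ i, CStarMatrix (B.n i) (B.n i) ℂ

/-- The trace on `⨁ i, M_{n i}(ℂ)` which takes the value `1` on each minimal projection: the sum
of the matrix traces of the components. -/
noncomputable def tr (B : FinDimData) (x : B.Alg) : ℂ := ∑ i, ∑ j, x i j j

end FinDimData

/-! ### Approximation pressure -/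

section Pressure

variable {A H : Type*} [CStarAlgebra A] [PartialOrder A] [StarOrderedRing A]
  [NormedAddCommGroup H] [InnerProductSpace ℂ H] [CompleteSpace H]

/-- The set `CPA(π, S, δ)` of triples `(φ, ψ, B)` where `B` is a finite-dimensional C⋆-algebra and
`φ : A → B`, `ψ : B → B(H)` are u.c.p. maps with `‖ψ (φ x) - π x‖ < δ` for all `x ∈ S`. -/
structure CPA (π : A →⋆ₐ[ℂ] (H →L[ℂ] H)) (S : Set A) (δ : ℝ) where
  B : FinDimData
  φ : CompletelyPositiveMap A B.Alg
  ψ : CompletelyPositiveMap B.Alg (H →L[ℂ] H)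
  φ_one : φ 1 = 1
  ψ_one : ψ 1 = 1
  approx : ∀ x ∈ S, ‖ψ (φ x) - π x‖ < δ

/-- `Ω ∪ θ(Ω) ∪ ⋯ ∪ θ^{n-1}(Ω)`. -/
noncomputable def orbitSet (θ : CompletelyPositiveMap A A) (Ω : Finset A) (n : ℕ) : Set A :=
  {y | ∃ j < n, ∃ x ∈ Ω, y = θ^[j] x}

/-- `a + θ(a) + ⋯ + θ^{n-1}(a)`. -/
noncomputable def orbitSum (θ : CompletelyPositiveMap A A) (a : A) (n : ℕ) : A :=
  ∑ j ∈ Finset.range n, θ^[j] a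

/-- The partition function: the infimum of `Tr (exp (φ (a^{(n)})))` over all
`(φ, ψ, B) ∈ CPA(π, Ω^{(n)}, δ)`. For self-adjoint `a` these traces are nonnegative real numbers;
the infimum over the empty set would be `∞`. -/
noncomputable def partitionFunction (θ : CompletelyPositiveMap A A) (π : A →⋆ₐ[ℂ] (H →L[ℂ] H))
    (a : A) (Ω : Finset A) (δ : ℝ) (n : ℕ) : ℝ≥0∞ :=
  ⨅ c : CPA π (orbitSet θ Ω n) δ,
    ENNReal.ofReal (c.B.tr (NormedSpace.exp (c.φ (orbitSum θ a n)))).re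

/-- `limsup_n (1/n) log Z_{θ,n}(π, a, Ω, δ)`. -/
noncomputable def pressureAt (θ : CompletelyPositiveMap A A) (π : A →⋆ₐ[ℂ] (H →L[ℂ] H))
    (a : A) (Ω : Finset A) (δ : ℝ) : EReal :=
  limsup (fun n : ℕ => ENNReal.log (partitionFunction θ π a Ω δ n) / (n : EReal)) atTop

/-- The approximation pressure `P_θ(π, a)`: the supremum of `P_θ(π, a, Ω, δ)` over all finite
`Ω ⊆ A` and all `δ > 0`. -/
noncomputable def pressure (θ : CompletelyPositiveMap A A) (π : A →⋆ₐ[ℂ] (H →L[ℂ] H))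
    (a : A) : EReal :=
  ⨆ (Ω : Finset A) (δ : ℝ) (_ : 0 < δ), pressureAt θ π a Ω δ

end Pressure

end NCPressure

/-! Approximations tensor. If `c₁` and `c₂` are completely positive approximations for the two
systems, then φ₁ ⊗ φ₂ and ψ₁ ⊗ ψ₂ approximate the minimal tensor product through B₁ ⊗ B₂. The orbit
sum of a₁ ⊗ 1 + 1 ⊗ a₂ is a₁⁽ⁿ⁾ ⊗ 1 + 1 ⊗ a₂⁽ⁿ⁾, a sum of commuting terms, so the trace of its
exponential is the product of the two traces. Hence Z(n) ≤ Z₁(n) Z₂(n) for suitable finite sets and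
tolerance (`exists_cpa_tensor`), and taking logarithms and limsups gives the inequality
(`pressure_tmul_add_le`).

The analytic input is the existence of tensor products of u.c.p. maps and independence of the
representations. Both rest on `CPDom`, complete positivity of one operator-valued linear map
relative to another on a bare vector space, which makes sense on the algebraic tensor product before
any norm or order is available. It agrees with ordinary complete positivity
(`CompletelyPositiveMap.cpDom`, `CPDom.toCP`), implies contractivity for unital maps
(`CPDom.norm_le`), is stable under tensor products by slicing (`CPDom.tensor`) and passes to
closures (`CPDom.exists_extension`). This yields θ; density of the elementary tensors yields its
uniqueness.

For a change of representation, Arveson's theorem (`CPDom.exists_arveson_extension`) provides a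
u.c.p. map B(H) → B(K) carrying π to ρ. Composing ψ with it changes neither B nor φ, hence no trace.

In the extended reals the sum of the two limsups has to avoid ⊥ + ⊤. Over nonzero algebras this
follows from Tr eˣ ≥ e^(-‖x‖), which bounds the limsups below; if a factor is zero, so is the tensor
product, and its pressure is ⊥. -/

namespace NCPressure

/-! ### Positive elements and Jordan decomposition. -/

section CStar

variable {M : Type*} [NonUnitalCStarAlgebra M] [PartialOrder M] [StarOrderedRing M]

lemma exists_eq_star_mul_self {a : M} (ha : 0 ≤ a) : ∃ b, a = star b * b :=
  CStarAlgebra.nonneg_iff_eq_star_mul_self.mp ha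

lemma exists_orthogonal_decomposition {a : M} (ha : IsSelfAdjoint a) :
    ∃ p d : M, 0 ≤ p ∧ 0 ≤ d ∧ p - d = a ∧ p * d = 0 :=
  ⟨a⁺, a⁻, CFC.posPart_nonneg a, CFC.negPart_nonneg a, CFC.posPart_sub_negPart a ha,
    CFC.posPart_mul_negPart a⟩

end CStar

/-! ### Quadratic forms of operator matrices. -/

section Quad

variable {ι κ : Type*} [Fintype ι] [Fintype κ]
  {H : Type*} [NormedAddCommGroup H] [InnerProductSpace ℂ H]

/-- The form `∑ ⟪ξ i, T i j ξ j⟫` of an operator matrix. -/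
noncomputable def quad (T : ι → ι → (H →L[ℂ] H)) (ξ : ι → H) : ℂ :=
  ∑ i, ∑ j, inner ℂ (ξ i) (T i j (ξ j))

lemma quad_add (S T : ι → ι → (H →L[ℂ] H)) (ξ : ι → H) :
    quad (fun i j => S i j + T i j) ξ = quad S ξ + quad T ξ := by
  simp [quad, Finset.sum_add_distrib]

lemma quad_smul (c : ℂ) (T : ι → ι → (H →L[ℂ] H)) (ξ : ι → H) :
    quad (fun i j => c • T i j) ξ = c * quad T ξ := by
  simp [quad, Finset.mul_sum]

lemma quad_neg (T : ι → ι → (H →L[ℂ] H)) (ξ : ι → H) :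
    quad (fun i j => - T i j) ξ = - quad T ξ := by
  simp [quad]

lemma quad_reindex (e : κ ≃ ι) (T : ι → ι → (H →L[ℂ] H)) (ξ : ι → H) :
    quad (fun i j => T (e i) (e j)) (fun i => ξ (e i)) = quad T ξ := by
  simp only [quad]
  rw [← e.sum_comp (fun i => ∑ j, inner ℂ (ξ i) (T i j (ξ j)))]
  exact Finset.sum_congr rfl fun i _ => e.sum_comp (fun j => inner ℂ (ξ (e i)) (T (e i) j (ξ j)))

lemma quad_star [CompleteSpace H] (T : ι → ι → (H →L[ℂ] H)) (ξ : ι → H) :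
    quad (fun i j => star (T j i)) ξ = star (quad T ξ) := by
  simp only [quad, star_sum]
  rw [Finset.sum_comm]
  refine Finset.sum_congr rfl fun i _ => Finset.sum_congr rfl fun j _ => ?_
  rw [ContinuousLinearMap.star_eq_adjoint, ContinuousLinearMap.adjoint_inner_right]
  exact (inner_conj_symm _ _).symm

lemma inner_self_eq_ofReal (x : H) : inner ℂ x x = ((‖x‖ ^ 2 : ℝ) : ℂ) := by
  rw [inner_self_eq_norm_sq_to_K]; push_cast; rfl

lemma quad_diagonal [DecidableEq ι] (c : ℂ) (ξ : ι → H) :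
    quad (fun i j => if i = j then c • (1 : H →L[ℂ] H) else 0) ξ
      = c * ∑ i, ((‖ξ i‖ ^ 2 : ℝ) : ℂ) := by
  simp only [quad, Finset.mul_sum]
  refine Finset.sum_congr rfl fun i _ => ?_
  rw [Finset.sum_eq_single i]
  · simp
  · intro j _ hj
    simp [hj.symm]
  · simp

lemma norm_quad_le {T : ι → ι → (H →L[ℂ] H)} {ε : ℝ} (hT : ∀ i j, ‖T i j‖ ≤ ε) (ξ : ι → H) :
    ‖quad T ξ‖ ≤ ε * (∑ i, ‖ξ i‖) ^ 2 := by
  rw [sq, Finset.sum_mul_sum, Finset.mul_sum]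
  refine (norm_sum_le _ _).trans (Finset.sum_le_sum fun i _ => ?_)
  rw [Finset.mul_sum]
  refine (norm_sum_le _ _).trans (Finset.sum_le_sum fun j _ => ?_)
  calc ‖inner ℂ (ξ i) (T i j (ξ j))‖ ≤ ‖ξ i‖ * (‖T i j‖ * ‖ξ j‖) :=
        (norm_inner_le_norm _ _).trans (by gcongr; exact (T i j).le_opNorm _)
    _ ≤ ‖ξ i‖ * (ε * ‖ξ j‖) := by gcongr; exact hT i j
    _ = _ := by ring

/-- Complex polarization, with the matrix viewed as one operator on the ℓ² direct sum of copies of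
`H`. -/
lemma eq_zero_of_quad {T : ι → ι → (H →L[ℂ] H)} (h : ∀ ξ, quad T ξ = 0) : T = 0 := by
  classical
  let F : PiLp 2 (fun _ : ι => H) →ₗ[ℂ] PiLp 2 (fun _ : ι => H) :=
    { toFun := fun ξ => WithLp.toLp 2 fun i => ∑ j, T i j (ξ j)
      map_add' := fun ξ η => by ext i; simp [Finset.sum_add_distrib]
      map_smul' := fun c ξ => by ext i; simp [Finset.smul_sum] }
  have hF : F = 0 := by
    rw [← inner_map_self_eq_zero]
    intro ξ
    rw [← inner_conj_symm, PiLp.inner_apply, ← map_zero (starRingEnd ℂ), ← h ξ.ofLp]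
    simp [F, quad, sum_inner]
  ext i j x
  have h1 := congrArg (fun ξ => ξ i) (LinearMap.congr_fun hF (WithLp.toLp 2 (Pi.single j x)))
  simp only [F, LinearMap.coe_mk, AddHom.coe_mk, LinearMap.zero_apply, PiLp.zero_apply] at h1
  rw [Finset.sum_eq_single j] at h1
  · simpa using h1
  · intro b _ hb
    simp [hb]
  · simp

variable [CompleteSpace H] {A : Type*} [CStarAlgebra A]

lemma quad_conj (π : A →⋆ₐ[ℂ] (H →L[ℂ] H)) (C N : CStarMatrix ι ι A) (ξ : ι → H) :
    quad (fun i j => π ((star C * N * C) i j)) ξ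
      = quad (fun i j => π (N i j)) (fun i => ∑ j, π (C i j) (ξ j)) := by
  simp only [quad, CStarMatrix.mul_apply, CStarMatrix.star_apply, map_sum, map_mul,
    Finset.sum_mul, sum_apply, mul_apply_eq_comp, inner_sum,
    sum_inner, map_star, ContinuousLinearMap.star_eq_adjoint,
    ContinuousLinearMap.adjoint_inner_right]
  calc _ = ∑ i, ∑ k, ∑ j, ∑ l,
      inner ℂ (π (C l i) (ξ i)) (π (N l k) (π (C k j) (ξ j))) :=
        Finset.sum_congr rfl fun i _ => Finset.sum_comm
    _ = ∑ k, ∑ i, ∑ j, ∑ l,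
      inner ℂ (π (C l i) (ξ i)) (π (N l k) (π (C k j) (ξ j))) := Finset.sum_comm
    _ = ∑ k, ∑ i, ∑ l, ∑ j,
      inner ℂ (π (C l i) (ξ i)) (π (N l k) (π (C k j) (ξ j))) :=
        Finset.sum_congr rfl fun i _ => Finset.sum_congr rfl fun i _ => Finset.sum_comm
    _ = ∑ k, ∑ l, ∑ i, ∑ j,
      inner ℂ (π (C l i) (ξ i)) (π (N l k) (π (C k j) (ξ j))) :=
        Finset.sum_congr rfl fun i _ => Finset.sum_comm
    _ = ∑ l, ∑ k, ∑ i, ∑ j,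
      inner ℂ (π (C l i) (ξ i)) (π (N l k) (π (C k j) (ξ j))) := Finset.sum_comm
    _ = _ := Finset.sum_congr rfl fun i _ => Finset.sum_congr rfl fun i _ => Finset.sum_comm

lemma quad_star_mul_self (π : A →⋆ₐ[ℂ] (H →L[ℂ] H)) (C : CStarMatrix ι ι A) (ξ : ι → H) :
    quad (fun i j => π ((star C * C) i j)) ξ
      = ((∑ i, ‖∑ j, π (C i j) (ξ j)‖ ^ 2 : ℝ) : ℂ) := by
  classical
  have h := quad_conj π C 1 ξ
  rw [mul_one] at h
  rw [h]
  have h2 := quad_diagonal 1 (fun i => ∑ j, π (C i j) (ξ j))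
  rw [one_mul] at h2
  push_cast at h2 ⊢
  rw [← h2]
  congr 1
  ext i j
  by_cases hij : i = j <;> simp [CStarMatrix.one_apply, hij]

lemma quad_nonneg [PartialOrder A] [StarOrderedRing A] (π : A →⋆ₐ[ℂ] (H →L[ℂ] H))
    {M : CStarMatrix ι ι A} (hM : 0 ≤ M) (ξ : ι → H) : 0 ≤ quad (fun i j => π (M i j)) ξ := by
  classical
  obtain ⟨C, rfl⟩ := exists_eq_star_mul_self hM
  rw [quad_star_mul_self, Complex.zero_le_real]
  positivity

lemma eq_zero_of_quad_star_mul_self (π : A →⋆ₐ[ℂ] (H →L[ℂ] H)) (hπ : Function.Injective π)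
    (C : CStarMatrix ι ι A) (h : ∀ ξ, quad (fun i j => π ((star C * C) i j)) ξ = 0) : C = 0 := by
  classical
  ext k j
  apply hπ
  ext x
  have h1 := h (Pi.single j x)
  rw [quad_star_mul_self, Complex.ofReal_eq_zero,
    Finset.sum_eq_zero_iff_of_nonneg (fun _ _ => by positivity)] at h1
  have h2 := h1 k (Finset.mem_univ _)
  rw [sq_eq_zero_iff, norm_eq_zero, Finset.sum_eq_single j] at h2
  · simpa using h2
  · intro b _ hb
    simp [hb]
  · simp

/-- A self-adjoint matrix over a C⋆-algebra whose form is nonnegative in some faithful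
representation is nonnegative. -/
lemma nonneg_of_quad [PartialOrder A] [StarOrderedRing A] (π : A →⋆ₐ[ℂ] (H →L[ℂ] H))
    (hπ : Function.Injective π) {N : CStarMatrix ι ι A} (hN : IsSelfAdjoint N)
    (h : ∀ ξ, 0 ≤ (quad (fun i j => π (N i j)) ξ).re) : 0 ≤ N := by
  classical
  obtain ⟨P, D, hP0, hD0, hsub, hmul⟩ := exists_orthogonal_decomposition hN
  have hDs : star D = D := (IsSelfAdjoint.of_nonneg hD0).star_eq
  -- With D the negative part of N, D N D = -D³. The form of D N D is that of N at other vectors, so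
  -- its real part is nonnegative, while D³ ≥ 0. Hence D³ = 0 and then D = 0.
  have hconj : star D * N * D = - (star D * D * D) := by
    have : N * D = - (D * D) := by
      conv_lhs => rw [← hsub]
      rw [sub_mul, hmul, zero_sub]
    rw [mul_assoc, this, mul_neg, mul_assoc]
  have h3 : 0 ≤ star D * D * D := star_left_conjugate_nonneg hD0 D
  obtain ⟨C, hC⟩ := exists_eq_star_mul_self h3
  have hC0 : C = 0 := by
    refine eq_zero_of_quad_star_mul_self π hπ C fun ξ => ?_
    have h4 : 0 ≤ (quad (fun i j => π ((star D * N * D) i j)) ξ).re := by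
      rw [quad_conj]; exact h _
    have h5 : quad (fun i j => π ((star D * N * D) i j)) ξ
        = - quad (fun i j => π ((star C * C) i j)) ξ := by
      rw [hconj, hC, ← quad_neg]
      congr 1
      ext i j : 2
      simp
    rw [h5, quad_star_mul_self] at h4
    rw [quad_star_mul_self]
    have h6 : (0 : ℝ) ≤ ∑ i, ‖∑ j, π (C i j) (ξ j)‖ ^ 2 := by positivity
    rw [← Complex.ofReal_neg, Complex.ofReal_re] at h4
    rw [Complex.ofReal_eq_zero]
    linarith
  have hcube : D * D * D = 0 := by
    rw [hC0, hDs] at hC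
    simpa using hC
  have hsq : D * D = 0 := by
    rw [← CStarRing.star_mul_self_eq_zero_iff, star_mul, hDs]
    rw [← mul_assoc, hcube, zero_mul]
  have hz : D = 0 := by
    rw [← CStarRing.star_mul_self_eq_zero_iff, hDs, hsq]
  rw [← hsub, hz, sub_zero]
  exact hP0

end Quad

/-! ### Relative complete positivity. -/

section CPDom

variable {V W H K L A B : Type*} [AddCommGroup V] [Module ℂ V] [AddCommGroup W] [Module ℂ W]
  [NormedAddCommGroup H] [InnerProductSpace ℂ H]
  [NormedAddCommGroup K] [InnerProductSpace ℂ K]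
  [NormedAddCommGroup L] [InnerProductSpace ℂ L]

/-- `α` is completely positive relative to `π`: whenever the real part of the form of the matrix
`(π (M i j))` is nonnegative, so is the real part of the form of `(α (M i j))`. -/
def CPDom (π : V →ₗ[ℂ] (H →L[ℂ] H)) (α : V →ₗ[ℂ] (L →L[ℂ] L)) : Prop :=
  ∀ (n : ℕ) (M : Fin n → Fin n → V), (∀ ξ, 0 ≤ (quad (fun i j => π (M i j)) ξ).re) →
    ∀ ξ, 0 ≤ (quad (fun i j => α (M i j)) ξ).re

variable {π : V →ₗ[ℂ] (H →L[ℂ] H)} {α : V →ₗ[ℂ] (L →L[ℂ] L)} {β : V →ₗ[ℂ] (K →L[ℂ] K)}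

lemma CPDom.trans (h₁ : CPDom π α) (h₂ : CPDom α β) : CPDom π β :=
  fun n M hM => h₂ n M (h₁ n M hM)

lemma CPDom.comp (h : CPDom π α) (f : W →ₗ[ℂ] V) : CPDom (π ∘ₗ f) (α ∘ₗ f) :=
  fun n M hM => h n (fun i j => f (M i j)) hM

lemma CPDom.re_nonneg (h : CPDom π α) {ι : Type*} [Fintype ι] (M : ι → ι → V)
    (hM : ∀ ξ, 0 ≤ (quad (fun i j => π (M i j)) ξ).re) (ξ : ι → L) :
    0 ≤ (quad (fun i j => α (M i j)) ξ).re := by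
  let e := (Fintype.equivFin ι).symm
  rw [← quad_reindex e]
  refine h _ (fun i j => M (e i) (e j)) (fun η => ?_) _
  have := hM (fun i => η (e.symm i))
  rw [← quad_reindex e] at this
  simpa using this

/-- A form that is real for `π` stays of nonnegative real part when the matrix is multiplied by i or
-i. Applying `h` to both multiples kills the imaginary part for `α`. -/
lemma CPDom.nonneg (h : CPDom π α) {ι : Type*} [Fintype ι] (M : ι → ι → V)
    (hM : ∀ ξ, 0 ≤ quad (fun i j => π (M i j)) ξ) (ξ : ι → L) :
    0 ≤ quad (fun i j => α (M i j)) ξ := by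
  rw [Complex.nonneg_iff]
  refine ⟨h.re_nonneg M (fun ξ => (Complex.nonneg_iff.mp (hM ξ)).1) ξ, ?_⟩
  have key : ∀ c : ℂ, c.re = 0 → 0 ≤ (c * quad (fun i j => α (M i j)) ξ).re := by
    intro c hc
    have h1 := h.re_nonneg (fun i j => c • M i j) (fun η => ?_) ξ
    · simpa only [map_smul, quad_smul] using h1
    · simp only [map_smul, quad_smul, Complex.mul_re, hc, ← (Complex.nonneg_iff.mp (hM η)).2]
      simp
  have h1 := key Complex.I (by simp)
  have h2 := key (-Complex.I) (by simp)
  simp only [Complex.mul_re, Complex.I_re, Complex.I_im, Complex.neg_re, Complex.neg_im] at h1 h2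
  linarith

/-- A map which is completely positive relative to `π` and respects the unit is contractive. -/
lemma CPDom.norm_le (h : CPDom π α) {e : V} (hπ : π e = 1) (hα : α e = 1) (v : V) :
    ‖α v‖ ≤ ‖π v‖ := by
  refine ContinuousLinearMap.opNorm_le_bound _ (norm_nonneg _) fun y => ?_
  have key : ∀ (x y : L) (c : ℂ), ‖c‖ = 1 →
      0 ≤ ‖π v‖ * (‖x‖ ^ 2 + ‖y‖ ^ 2) + 2 * (c * inner ℂ x (α v y)).re := by
    intro x y c hc
    -- Only the real part of the form matters, so a triangular matrix replaces the usual Hermitian 2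
    -- × 2 matrix. For `π` its form is nonnegative by Cauchy–Schwarz and the inequality between
    -- arithmetic and geometric means.
    have h1 := h 2 ![![(‖π v‖ : ℂ) • e, (2 * c) • v], ![0, (‖π v‖ : ℂ) • e]] (fun ξ => ?_) ![x, y]
    · simp only [quad, Fin.sum_univ_two, Matrix.cons_val_zero, Matrix.cons_val_one, map_smul, hα,
        smul_apply, one_apply_eq_self, inner_smul_right,
        map_zero, zero_apply, inner_zero_right,
        inner_self_eq_ofReal] at h1
      have h2 : ((2 * c) * inner ℂ x (α v y)).re = 2 * (c * inner ℂ x (α v y)).re := by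
        rw [mul_assoc]; simp
      simp only [Complex.add_re, h2, Complex.zero_re, Complex.re_ofReal_mul,
        Complex.ofReal_re] at h1
      linarith
    · simp only [quad, Fin.sum_univ_two, Matrix.cons_val_zero, Matrix.cons_val_one, map_smul, hπ,
        smul_apply, one_apply_eq_self, inner_smul_right,
        map_zero, zero_apply, inner_zero_right,
        inner_self_eq_ofReal]
      have h2 : ((2 * c) * inner ℂ (ξ 0) (π v (ξ 1))).re
          = 2 * (c * inner ℂ (ξ 0) (π v (ξ 1))).re := by
        rw [mul_assoc]; simp
      simp only [Complex.add_re, h2, Complex.zero_re, Complex.re_ofReal_mul, Complex.ofReal_re]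
      have h3 : ‖c * inner ℂ (ξ 0) (π v (ξ 1))‖ ≤ ‖ξ 0‖ * (‖π v‖ * ‖ξ 1‖) := by
        rw [norm_mul, hc, one_mul]
        exact (norm_inner_le_norm _ _).trans (by gcongr; exact (π v).le_opNorm _)
      have h4 := (abs_le.mp (Complex.abs_re_le_norm (c * inner ℂ (ξ 0) (π v (ξ 1))))).1
      nlinarith [mul_nonneg (norm_nonneg (π v)) (sq_nonneg (‖ξ 0‖ - ‖ξ 1‖))]
  rcases eq_or_ne (α v y) 0 with h0 | h0
  · rw [h0, norm_zero]; positivity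
  have hy : 0 < ‖y‖ := by
    rw [norm_pos_iff]; rintro rfl; simp at h0
  have hz : 0 < ‖α v y‖ := norm_pos_iff.mpr h0
  -- The first vector is parallel to `α v y` and rescaled to the norm of `y`, which makes both of
  -- these inequalities sharp.
  have h5 := key (((‖y‖ / ‖α v y‖ : ℝ) : ℂ) • α v y) y (-1) (by simp)
  rw [inner_smul_left, inner_self_eq_ofReal, Complex.conj_ofReal, norm_smul,
    Complex.norm_real, Real.norm_of_nonneg (by positivity), ← Complex.ofReal_mul,
    neg_one_mul, Complex.neg_re, Complex.ofReal_re] at h5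
  have h6 : ‖y‖ / ‖α v y‖ * ‖α v y‖ ^ 2 = ‖y‖ * ‖α v y‖ := by field_simp
  have h7 : ‖y‖ / ‖α v y‖ * ‖α v y‖ = ‖y‖ := by field_simp
  rw [h6, h7] at h5
  have h8 : ‖y‖ * ‖α v y‖ ≤ ‖y‖ * (‖π v‖ * ‖y‖) := by linarith
  exact le_of_mul_le_mul_left h8 hy

variable [CompleteSpace H] [CompleteSpace L] [CStarAlgebra A] [PartialOrder A] [StarOrderedRing A]
  [CStarAlgebra B] [PartialOrder B] [StarOrderedRing B]

/-- The underlying linear map of a representation. -/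
noncomputable def repLin (π : A →⋆ₐ[ℂ] (H →L[ℂ] H)) : A →ₗ[ℂ] (H →L[ℂ] H) :=
  π.toAlgHom.toLinearMap

@[simp] lemma repLin_apply {A : Type*} [CStarAlgebra A] (π : A →⋆ₐ[ℂ] (H →L[ℂ] H)) (a : A) :
    repLin π a = π a := rfl

/-- The real part of the form of M is half the form of M + M*. The latter matrix is positive by
`nonneg_of_quad`, where faithfulness of `π` enters, so `φ` maps it to a positive matrix. -/
lemma CompletelyPositiveMap.cpDom (φ : CompletelyPositiveMap A B) (π : A →⋆ₐ[ℂ] (H →L[ℂ] H))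
    (hπ : Function.Injective π) (σ : B →⋆ₐ[ℂ] (L →L[ℂ] L)) :
    CPDom (repLin π) (repLin σ ∘ₗ φ.toLinearMap) := by
  intro n M hM ξ
  let M' : CStarMatrix (Fin n) (Fin n) A := CStarMatrix.ofMatrix M
  have h1 : 0 ≤ M' + star M' := by
    refine nonneg_of_quad π hπ (IsSelfAdjoint.add_star_self M') fun ξ => ?_
    have : quad (fun i j => π ((M' + star M') i j)) ξ
        = quad (fun i j => π (M i j)) ξ + star (quad (fun i j => π (M i j)) ξ) := by
      rw [← quad_star, ← quad_add]
      simp only [CStarMatrix.add_apply, CStarMatrix.star_apply, map_add, map_star]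
      rfl
    rw [this]
    have := hM ξ
    simp only [repLin_apply] at this
    simpa using this
  have h2 := quad_nonneg σ (φ.map_cstarMatrix_nonneg _ h1) ξ
  have h3 : quad (fun i j => σ (((M' + star M').map φ) i j)) ξ
      = quad (fun i j => σ (φ (M i j))) ξ + star (quad (fun i j => σ (φ (M i j))) ξ) := by
    rw [← quad_star, ← quad_add]
    simp only [CStarMatrix.map_apply, CStarMatrix.add_apply, CStarMatrix.star_apply, map_add,
      map_star]
    rfl
  rw [h3] at h2
  have h4 := (Complex.nonneg_iff.mp h2).1
  simp only [Complex.add_re, RCLike.star_def, Complex.conj_re] at h4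
  change 0 ≤ (quad (fun i j => σ (φ (M i j))) ξ).re
  linarith

/-- The completely positive map with a given underlying linear map which is completely positive
relative to representations, the one of the target being faithful. -/
noncomputable def CPDom.toCP {φ : A →ₗ[ℂ] B} (π : A →⋆ₐ[ℂ] (H →L[ℂ] H))
    {σ : B →⋆ₐ[ℂ] (L →L[ℂ] L)} (hσ : Function.Injective σ)
    (h : CPDom (repLin π) (repLin σ ∘ₗ φ)) : CompletelyPositiveMap A B where
  toLinearMap := φ
  map_cstarMatrix_nonneg' k M hM := by
    have h1 : ∀ ξ, 0 ≤ quad (fun i j => σ ((M.map φ) i j)) ξ :=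
      h.nonneg (fun i j => M i j) (quad_nonneg π hM)
    refine nonneg_of_quad σ hσ ?_ fun ξ => (Complex.nonneg_iff.mp (h1 ξ)).1
    -- The form of the image is real, so its matrix and the adjoint have equal forms; polarization
    -- makes them equal.
    have h2 : star (M.map φ) - M.map φ = 0 := by
      ext i j
      apply hσ
      have h3 := eq_zero_of_quad (T := fun i j => σ ((star (M.map φ) - M.map φ) i j))
        fun ξ => ?_
      · simpa using congrFun (congrFun h3 i) j
      · have h4 : quad (fun i j => σ ((star (M.map φ) - M.map φ) i j)) ξ
            = star (quad (fun i j => σ ((M.map φ) i j)) ξ)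
              + -quad (fun i j => σ ((M.map φ) i j)) ξ := by
          rw [← quad_star, ← quad_neg, ← quad_add]
          congr 1
          ext i j : 2
          rw [CStarMatrix.sub_apply, CStarMatrix.star_apply, map_sub, map_star, sub_eq_add_neg]
        rw [h4, (IsSelfAdjoint.of_nonneg (h1 ξ)).star_eq, add_neg_cancel]
    exact sub_eq_zero.mp h2

end CPDom

/-! ### Operators on the Hilbert space tensor product. -/

section HilbertTensor

variable {H₁ H₂ : Type*}
  [NormedAddCommGroup H₁] [InnerProductSpace ℂ H₁]
  [NormedAddCommGroup H₂] [InnerProductSpace ℂ H₂]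

/-- The embedding of the algebraic tensor product into the Hilbert space tensor product. -/
noncomputable def toHT : (H₁ ⊗[ℂ] H₂) →ₗᵢ[ℂ] HilbertTensor H₁ H₂ :=
  UniformSpace.Completion.toComplₗᵢ

lemma denseRange_toHT : DenseRange (toHT : (H₁ ⊗[ℂ] H₂) → HilbertTensor H₁ H₂) :=
  UniformSpace.Completion.denseRange_coe

@[simp] lemma tensorOp_toHT (S : H₁ →L[ℂ] H₁) (T : H₂ →L[ℂ] H₂) (z : H₁ ⊗[ℂ] H₂) :
    tensorOp S T (toHT z) = toHT (TensorProduct.mapL S T z) :=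
  UniformSpace.Completion.map_coe (TensorProduct.mapL S T).uniformContinuous z

lemma hilbertTensor_clm_ext {E : Type*} [NormedAddCommGroup E] [NormedSpace ℂ E]
    {S T : HilbertTensor H₁ H₂ →L[ℂ] E} (h : ∀ x y, S (toHT (x ⊗ₜ y)) = T (toHT (x ⊗ₜ y))) :
    S = T := by
  have h1 : ∀ z, S (toHT z) = T (toHT z) := by
    intro z
    induction z with
    | zero => simp
    | tmul x y => exact h x y
    | add a b ha hb => simp [ha, hb]
  ext z
  exact congrFun (denseRange_toHT.equalizer S.continuous T.continuous (funext h1)) z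

lemma hilbertTensor_clm_ext_inner {S T : HilbertTensor H₁ H₂ →L[ℂ] HilbertTensor H₁ H₂}
    (h : ∀ x y x' y', inner ℂ (toHT (x ⊗ₜ[ℂ] y)) (S (toHT (x' ⊗ₜ[ℂ] y')))
      = inner ℂ (toHT (x ⊗ₜ[ℂ] y)) (T (toHT (x' ⊗ₜ[ℂ] y')))) : S = T := by
  refine hilbertTensor_clm_ext fun x' y' => ?_
  refine ext_inner_left ℂ fun v => ?_
  have h1 : innerSL ℂ (S (toHT (x' ⊗ₜ[ℂ] y'))) = innerSL ℂ (T (toHT (x' ⊗ₜ[ℂ] y'))) := by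
    refine hilbertTensor_clm_ext fun x y => ?_
    simp only [innerSL_apply_apply]
    rw [← inner_conj_symm, h, inner_conj_symm]
  rw [← inner_conj_symm, ← innerSL_apply_apply, h1, innerSL_apply_apply, inner_conj_symm]

lemma tensorOp_add_left (S S' : H₁ →L[ℂ] H₁) (T : H₂ →L[ℂ] H₂) :
    tensorOp (S + S') T = tensorOp S T + tensorOp S' T :=
  hilbertTensor_clm_ext fun x y => by simp [TensorProduct.add_tmul]

lemma tensorOp_add_right (S : H₁ →L[ℂ] H₁) (T T' : H₂ →L[ℂ] H₂) :
    tensorOp S (T + T') = tensorOp S T + tensorOp S T' :=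
  hilbertTensor_clm_ext fun x y => by simp [TensorProduct.tmul_add]

lemma tensorOp_smul_left (c : ℂ) (S : H₁ →L[ℂ] H₁) (T : H₂ →L[ℂ] H₂) :
    tensorOp (c • S) T = c • tensorOp S T :=
  hilbertTensor_clm_ext fun x y => by
    simp only [tensorOp_toHT, TensorProduct.mapL_tmul, smul_apply, ← TensorProduct.smul_tmul',
      map_smul]

lemma tensorOp_smul_right (c : ℂ) (S : H₁ →L[ℂ] H₁) (T : H₂ →L[ℂ] H₂) :
    tensorOp S (c • T) = c • tensorOp S T :=
  hilbertTensor_clm_ext fun x y => by simp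

lemma tensorOp_one : tensorOp (1 : H₁ →L[ℂ] H₁) (1 : H₂ →L[ℂ] H₂) = 1 :=
  hilbertTensor_clm_ext fun x y => by simp

lemma tensorOp_mul (S S' : H₁ →L[ℂ] H₁) (T T' : H₂ →L[ℂ] H₂) :
    tensorOp (S * S') (T * T') = tensorOp S T * tensorOp S' T' :=
  hilbertTensor_clm_ext fun x y => by simp

lemma inner_tensorOp (S : H₁ →L[ℂ] H₁) (T : H₂ →L[ℂ] H₂) (x x' : H₁) (y y' : H₂) :
    inner ℂ (toHT (x ⊗ₜ[ℂ] y)) (tensorOp S T (toHT (x' ⊗ₜ[ℂ] y')))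
      = inner ℂ x (S x') * inner ℂ y (T y') := by
  rw [tensorOp_toHT, LinearIsometry.inner_map_map]
  simp

lemma tensorOp_star [CompleteSpace H₁] [CompleteSpace H₂] (S : H₁ →L[ℂ] H₁) (T : H₂ →L[ℂ] H₂) :
    star (tensorOp S T) = tensorOp (star S) (star T) := by
  refine hilbertTensor_clm_ext_inner fun x y x' y' => ?_
  rw [inner_tensorOp, ContinuousLinearMap.star_eq_adjoint, ContinuousLinearMap.adjoint_inner_right,
    ← inner_conj_symm, inner_tensorOp]
  simp only [ContinuousLinearMap.star_eq_adjoint, ContinuousLinearMap.adjoint_inner_right, map_mul,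
    inner_conj_symm]

lemma norm_tensorOp_le (S : H₁ →L[ℂ] H₁) (T : H₂ →L[ℂ] H₂) : ‖tensorOp S T‖ ≤ ‖S‖ * ‖T‖ := by
  refine ContinuousLinearMap.opNorm_le_bound _ (by positivity) fun z => ?_
  refine denseRange_toHT.induction_on z (isClosed_le (by fun_prop) (by fun_prop)) fun w => ?_
  rw [tensorOp_toHT, LinearIsometry.norm_map, LinearIsometry.norm_map]
  exact (ContinuousLinearMap.le_opNorm _ _).trans
    (by gcongr; exact TensorProduct.norm_mapL_le S T)

/-- `tensorOp` as a bilinear map. -/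
noncomputable def tensorOpₗ :
    (H₁ →L[ℂ] H₁) →ₗ[ℂ] (H₂ →L[ℂ] H₂) →ₗ[ℂ] (HilbertTensor H₁ H₂ →L[ℂ] HilbertTensor H₁ H₂) :=
  LinearMap.mk₂ ℂ tensorOp tensorOp_add_left tensorOp_smul_left tensorOp_add_right
    tensorOp_smul_right

end HilbertTensor

/-! ### Tensor products of relatively completely positive maps. -/

section TensorLin

variable {V₁ V₂ L₁ L₂ H₁ H₂ : Type*} [AddCommGroup V₁] [Module ℂ V₁] [AddCommGroup V₂] [Module ℂ V₂]
  [NormedAddCommGroup L₁] [InnerProductSpace ℂ L₁]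
  [NormedAddCommGroup L₂] [InnerProductSpace ℂ L₂]
  [NormedAddCommGroup H₁] [InnerProductSpace ℂ H₁]
  [NormedAddCommGroup H₂] [InnerProductSpace ℂ H₂]

/-- The tensor product of two operator-valued linear maps. -/
noncomputable def tensorLin (α : V₁ →ₗ[ℂ] (L₁ →L[ℂ] L₁)) (β : V₂ →ₗ[ℂ] (L₂ →L[ℂ] L₂)) :
    (V₁ ⊗[ℂ] V₂) →ₗ[ℂ] (HilbertTensor L₁ L₂ →L[ℂ] HilbertTensor L₁ L₂) :=
  TensorProduct.lift (tensorOpₗ.compl₁₂ α β)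

@[simp] lemma tensorLin_tmul (α : V₁ →ₗ[ℂ] (L₁ →L[ℂ] L₁)) (β : V₂ →ₗ[ℂ] (L₂ →L[ℂ] L₂)) (x : V₁)
    (y : V₂) : tensorLin α β (x ⊗ₜ y) = tensorOp (α x) (β y) := rfl

/-- The matrix coefficient `v ↦ ⟪e, β v f⟫`. -/
noncomputable def coeffLin (β : V₂ →ₗ[ℂ] (L₂ →L[ℂ] L₂)) (e f : L₂) : V₂ →ₗ[ℂ] ℂ where
  toFun v := inner ℂ e (β v f)
  map_add' := by simp
  map_smul' := by simp

/-- The right slice map `x ⊗ y ↦ ⟪e, β y f⟫ x`. -/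
noncomputable def sliceRight (β : V₂ →ₗ[ℂ] (L₂ →L[ℂ] L₂)) (e f : L₂) : (V₁ ⊗[ℂ] V₂) →ₗ[ℂ] V₁ :=
  (TensorProduct.rid ℂ V₁).toLinearMap ∘ₗ (coeffLin β e f).lTensor V₁

/-- The left slice map `x ⊗ y ↦ ⟪e, α x f⟫ y`. -/
noncomputable def sliceLeft (α : V₁ →ₗ[ℂ] (L₁ →L[ℂ] L₁)) (e f : L₁) : (V₁ ⊗[ℂ] V₂) →ₗ[ℂ] V₂ :=
  (TensorProduct.lid ℂ V₂).toLinearMap ∘ₗ (coeffLin α e f).rTensor V₂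

/-- With the second legs fixed, `tensorLin α β` acts as `α` on a slice. The slice does not depend on
`α`, so positivity can be compared between two choices of the first map. -/
lemma inner_tensorLin_right (α : V₁ →ₗ[ℂ] (L₁ →L[ℂ] L₁)) (β : V₂ →ₗ[ℂ] (L₂ →L[ℂ] L₂))
    (z : V₁ ⊗[ℂ] V₂) (ξ η : L₁) (e f : L₂) :
    inner ℂ (toHT (ξ ⊗ₜ[ℂ] e)) (tensorLin α β z (toHT (η ⊗ₜ[ℂ] f)))
      = inner ℂ ξ (α (sliceRight β e f z) η) := by
  induction z with
  | zero => simp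
  | tmul x y => simp [-tensorOp_toHT, inner_tensorOp, sliceRight, coeffLin, mul_comm]
  | add a b ha hb => simp [-tensorOp_toHT, ha, hb]

lemma inner_tensorLin_left (α : V₁ →ₗ[ℂ] (L₁ →L[ℂ] L₁)) (β : V₂ →ₗ[ℂ] (L₂ →L[ℂ] L₂))
    (z : V₁ ⊗[ℂ] V₂) (ξ η : L₁) (e f : L₂) :
    inner ℂ (toHT (ξ ⊗ₜ[ℂ] e)) (tensorLin α β z (toHT (η ⊗ₜ[ℂ] f)))
      = inner ℂ e (β (sliceLeft α ξ η z) f) := by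
  induction z with
  | zero => simp
  | tmul x y => simp [-tensorOp_toHT, inner_tensorOp, sliceLeft, coeffLin]
  | add a b ha hb => simp [-tensorOp_toHT, ha, hb]

/-- Splitting each vector into summands enlarges the index set and repeats rows and columns. Forms
at sums of elementary tensors thus become forms at elementary tensors. -/
lemma quad_sigma {ι : Type*} [Fintype ι] {κ : ι → Type*} [∀ i, Fintype (κ i)]
    {H : Type*} [NormedAddCommGroup H] [InnerProductSpace ℂ H]
    (T : ι → ι → (H →L[ℂ] H)) (ζ : (Σ i, κ i) → H) :
    quad T (fun i => ∑ s, ζ ⟨i, s⟩) = quad (fun P Q : Σ i, κ i => T P.1 Q.1) ζ := by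
  simp only [quad, Fintype.sum_sigma, sum_inner, map_sum, inner_sum]
  refine Finset.sum_congr rfl fun i _ => ?_
  rw [Finset.sum_comm]
  exact Finset.sum_congr rfl fun j _ => Finset.sum_comm

lemma re_quad_nonneg_of_dense {n : ℕ} (T : Fin n → Fin n →
      (HilbertTensor L₁ L₂ →L[ℂ] HilbertTensor L₁ L₂))
    (h : ∀ (S : Fin n → Finset (L₁ × L₂)),
      0 ≤ (quad (fun P Q : Σ i, S i => T P.1 Q.1)
        (fun P => toHT (P.2.1.1 ⊗ₜ[ℂ] P.2.1.2))).re) (ξ : Fin n → HilbertTensor L₁ L₂) :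
    0 ≤ (quad T ξ).re := by
  have hd : DenseRange (Pi.map fun _ : Fin n => (toHT : (L₁ ⊗[ℂ] L₂) → HilbertTensor L₁ L₂)) :=
    DenseRange.piMap fun _ => denseRange_toHT
  refine hd.induction_on ξ (isClosed_le continuous_const ?_) fun z => ?_
  · unfold quad
    fun_prop
  choose S hS using fun i => TensorProduct.exists_finset (z i)
  have h1 := h S
  rw [← quad_sigma] at h1
  convert h1 using 4 with i
  rw [Pi.map_apply, hS i, map_sum]
  exact (Finset.sum_coe_sort (S i) (fun s => toHT (s.1 ⊗ₜ[ℂ] s.2))).symm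

/-- At elementary tensors the form of α ⊗ β is the form of `α` on a matrix of slices. Its `π`-form
at arbitrary vectors η is the form of π ⊗ β at sums of tensors η ⊗ e, which `hX` controls. Only
coefficients of `β` enter, so no positivity of `β` is needed. -/
lemma CPDom.tensor_right {π : V₁ →ₗ[ℂ] (H₁ →L[ℂ] H₁)} {α : V₁ →ₗ[ℂ] (L₁ →L[ℂ] L₁)}
    (h : CPDom π α) (β : V₂ →ₗ[ℂ] (L₂ →L[ℂ] L₂)) : CPDom (tensorLin π β) (tensorLin α β) := by
  intro n X hX
  refine re_quad_nonneg_of_dense _ fun S => ?_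
  have h1 := h.re_nonneg (fun P Q : Σ i, S i =>
    sliceRight β P.2.1.2 Q.2.1.2 (X P.1 Q.1)) (fun η => ?_) (fun P => P.2.1.1)
  · simpa only [quad, inner_tensorLin_right] using h1
  · have h2 := hX fun i => ∑ s : S i, toHT (η ⟨i, s⟩ ⊗ₜ[ℂ] s.1.2)
    rw [quad_sigma (fun i j => tensorLin π β (X i j))
      (fun P : Σ i, S i => toHT (η P ⊗ₜ[ℂ] P.2.1.2))] at h2
    simpa only [quad, inner_tensorLin_right] using h2

lemma CPDom.tensor_left {π : V₂ →ₗ[ℂ] (H₂ →L[ℂ] H₂)} {β : V₂ →ₗ[ℂ] (L₂ →L[ℂ] L₂)}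
    (h : CPDom π β) (α : V₁ →ₗ[ℂ] (L₁ →L[ℂ] L₁)) : CPDom (tensorLin α π) (tensorLin α β) := by
  intro n X hX
  refine re_quad_nonneg_of_dense _ fun S => ?_
  have h1 := h.re_nonneg (fun P Q : Σ i, S i =>
    sliceLeft α P.2.1.1 Q.2.1.1 (X P.1 Q.1)) (fun η => ?_) (fun P => P.2.1.2)
  · simpa only [quad, inner_tensorLin_left] using h1
  · have h2 := hX fun i => ∑ s : S i, toHT (s.1.1 ⊗ₜ[ℂ] η ⟨i, s⟩)
    rw [quad_sigma (fun i j => tensorLin α π (X i j))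
      (fun P : Σ i, S i => toHT (P.2.1.1 ⊗ₜ[ℂ] η P))] at h2
    simpa only [quad, inner_tensorLin_left] using h2

/-- Tensor products of relatively completely positive maps. -/
lemma CPDom.tensor {π₁ : V₁ →ₗ[ℂ] (H₁ →L[ℂ] H₁)} {α : V₁ →ₗ[ℂ] (L₁ →L[ℂ] L₁)}
    {π₂ : V₂ →ₗ[ℂ] (H₂ →L[ℂ] H₂)} {β : V₂ →ₗ[ℂ] (L₂ →L[ℂ] L₂)}
    (h₁ : CPDom π₁ α) (h₂ : CPDom π₂ β) : CPDom (tensorLin π₁ π₂) (tensorLin α β) :=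
  (h₁.tensor_right π₂).trans (h₂.tensor_left α)

end TensorLin

/-! ### Extension by continuity. -/

section Extension

variable {V W H L : Type*} [AddCommGroup V] [Module ℂ V] [NormedAddCommGroup W] [NormedSpace ℂ W]
  [NormedAddCommGroup H] [InnerProductSpace ℂ H]
  [NormedAddCommGroup L] [InnerProductSpace ℂ L] [CompleteSpace L]

/-- Extension by continuity of a relatively completely positive map from a dense subspace. -/
lemma CPDom.exists_extension {t : V →ₗ[ℂ] W} (ht : DenseRange t) {π : W →ₗ[ℂ] (H →L[ℂ] H)}
    (hπ : ∀ w, ‖π w‖ = ‖w‖) {α : V →ₗ[ℂ] (L →L[ℂ] L)} (h : CPDom (π ∘ₗ t) α) {e : V}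
    (hπe : π (t e) = 1) (hαe : α e = 1) :
    ∃ Φ : W →L[ℂ] (L →L[ℂ] L), (∀ v, Φ (t v) = α v) ∧ CPDom π Φ.toLinearMap := by
  have hle : ∀ v, ‖α v‖ ≤ 1 * ‖t v‖ := by
    intro v
    rw [one_mul, ← hπ]
    exact h.norm_le hπe hαe v
  refine ⟨α.extendOfNorm t, LinearMap.extendOfNorm_eq ht ⟨1, hle⟩, fun n M hM ξ => ?_⟩
  set Φ := α.extendOfNorm t with hΦ
  have hΦt : ∀ v, Φ (t v) = α v := LinearMap.extendOfNorm_eq ht ⟨1, hle⟩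
  have hΦle : ∀ w, ‖Φ w‖ ≤ ‖w‖ := fun w => by
    simpa using LinearMap.norm_extendOfNorm_apply_le ht 1 hle w
  set s := (∑ i, ‖ξ i‖) ^ 2 with hs
  set q := ∑ i, ‖ξ i‖ ^ 2 with hq
  -- Replacing the entries of `M` by ε-close elements of the range of `t` changes the form at ζ by
  -- at most ε (∑ ‖ζ i‖)² ≤ ε n ∑ ‖ζ i‖². Adding ε n `e` on the diagonal restores positivity for
  -- `π`; for `Φ` both corrections vanish with ε.
  have key : ∀ ε > 0, 0 ≤ (quad (fun i j => Φ (M i j)) ξ).re + ε * (s + n * q) := by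
    intro ε hε
    choose X hX using fun i j => ht.exists_dist_lt (M i j) hε
    have h1 := h n (fun i j => X i j + if i = j then ((ε * n : ℝ) : ℂ) • e else 0) (fun ζ => ?_) ξ
    · have e1 : (fun i j => α (X i j + if i = j then ((ε * n : ℝ) : ℂ) • e else 0))
          = fun i j => (Φ (M i j) + Φ (t (X i j) - M i j))
            + if i = j then ((ε * n : ℝ) : ℂ) • (1 : L →L[ℂ] L) else 0 := by
        ext i j : 2
        rw [← map_add, add_sub_cancel, hΦt, map_add]
        split_ifs <;> simp [hαe]
      rw [e1, quad_add, quad_add, quad_diagonal, Complex.add_re, Complex.add_re,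
        ← Complex.ofReal_sum, ← Complex.ofReal_mul, Complex.ofReal_re] at h1
      have h2 : ‖quad (fun i j => Φ (t (X i j) - M i j)) ξ‖ ≤ ε * s :=
        norm_quad_le (fun i j => (hΦle _).trans (by
          rw [← dist_eq_norm, dist_comm]; exact (hX i j).le)) ξ
      have h3 := Complex.re_le_norm (quad (fun i j => Φ (t (X i j) - M i j)) ξ)
      nlinarith
    · have e1 : (fun i j => (π ∘ₗ t) (X i j + if i = j then ((ε * n : ℝ) : ℂ) • e else 0))
          = fun i j => (π (M i j) + π (t (X i j) - M i j))
            + if i = j then ((ε * n : ℝ) : ℂ) • (1 : H →L[ℂ] H) else 0 := by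
        ext i j : 2
        rw [← map_add, add_sub_cancel, map_add, LinearMap.comp_apply]
        split_ifs <;> simp [hπe]
      rw [e1, quad_add, quad_add, quad_diagonal, Complex.add_re, Complex.add_re,
        ← Complex.ofReal_sum, ← Complex.ofReal_mul, Complex.ofReal_re]
      have h2 : ‖quad (fun i j => π (t (X i j) - M i j)) ζ‖ ≤ ε * (∑ i, ‖ζ i‖) ^ 2 :=
        norm_quad_le (fun i j => (hπ _).le.trans (by
          rw [← dist_eq_norm, dist_comm]; exact (hX i j).le)) ζ
      have h3 := (abs_le.mp (Complex.abs_re_le_norm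
        (quad (fun i j => π (t (X i j) - M i j)) ζ))).1
      have h4 : (∑ i, ‖ζ i‖) ^ 2 ≤ n * ∑ i, ‖ζ i‖ ^ 2 := by
        simpa using sq_sum_le_card_mul_sum_sq (s := Finset.univ) (f := fun i => ‖ζ i‖)
      have h5 := hM ζ
      have h6 := mul_le_mul_of_nonneg_left h4 hε.le
      nlinarith
  refine le_of_forall_pos_le_add fun δ hδ => ?_
  have hc : 0 < s + n * q + 1 := by positivity
  have h1 := key (δ / (s + n * q + 1)) (by positivity)
  have h2 : δ / (s + n * q + 1) * (s + n * q) ≤ δ := by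
    rw [div_mul_eq_mul_div, div_le_iff₀ hc]
    nlinarith
  change 0 ≤ (quad (fun i j => Φ (M i j)) ξ).re + δ
  linarith

end Extension

/-! ### Arveson's extension theorem through the M. Riesz extension theorem. -/

section Arveson

variable {V H K L : Type*} [AddCommGroup V] [Module ℂ V]
  [NormedAddCommGroup H] [InnerProductSpace ℂ H]
  [NormedAddCommGroup K] [InnerProductSpace ℂ K]
  [NormedAddCommGroup L] [InnerProductSpace ℂ L] {J : Type*}

/-- The form `∑ ⟪h ξ, α (X (ξ, η)) (h η)⟫` of a finitely supported family. -/
noncomputable def pairing (α : V →ₗ[ℂ] (L →L[ℂ] L)) (h : J → L) : (J × J →₀ V) →ₗ[ℂ] ℂ :=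
  Finsupp.lsum ℂ fun p => coeffLin α (h p.1) (h p.2)

lemma pairing_single (α : V →ₗ[ℂ] (L →L[ℂ] L)) (h : J → L) (ξ η : J) (v : V) :
    pairing α h (Finsupp.single (ξ, η) v) = inner ℂ (h ξ) (α v (h η)) := by
  simp [pairing, coeffLin]

lemma pairing_apply (α : V →ₗ[ℂ] (L →L[ℂ] L)) (h : J → L) (X : J × J →₀ V) :
    pairing α h X = ∑ p ∈ X.support, inner ℂ (h p.1) (α (X p) (h p.2)) := by
  simp [pairing, coeffLin, Finsupp.sum]

lemma pairing_mapRange (π : V →ₗ[ℂ] (L →L[ℂ] L)) (h : J → L) (X : J × J →₀ V) :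
    pairing LinearMap.id h (Finsupp.mapRange.linearMap π X) = pairing π h X := by
  induction X using Finsupp.induction_linear with
  | zero => simp
  | add f g hf hg => simp only [map_add, hf, hg]
  | single p v => obtain ⟨ξ, η⟩ := p; simp [pairing_single]

lemma quad_sum_smul {ι : Type*} [Fintype ι] (S : Finset J) (c d : J → ι → ℂ) (X : J → V)
    (α : V →ₗ[ℂ] (L →L[ℂ] L)) (η : ι → L) :
    quad (fun i j => α (∑ p ∈ S, (starRingEnd ℂ (c p i) * d p j) • X p)) η
      = ∑ p ∈ S, inner ℂ (∑ i, c p i • η i) (α (X p) (∑ j, d p j • η j)) := by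
  simp only [quad, map_sum, map_smul, sum_apply, smul_apply, inner_sum, sum_inner,
    inner_smul_left, inner_smul_right]
  calc _ = ∑ i, ∑ p ∈ S, ∑ j, (starRingEnd ℂ (c p i) * d p j) * inner ℂ (η i) (α (X p) (η j)) :=
        Finset.sum_congr rfl fun i _ => Finset.sum_comm
    _ = ∑ p ∈ S, ∑ i, ∑ j, (starRingEnd ℂ (c p i) * d p j) * inner ℂ (η i) (α (X p) (η j)) :=
        Finset.sum_comm
    _ = ∑ p ∈ S, ∑ j, ∑ i, (starRingEnd ℂ (c p i) * d p j) * inner ℂ (η i) (α (X p) (η j)) :=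
        Finset.sum_congr rfl fun i _ => Finset.sum_comm
    _ = _ := by
        refine Finset.sum_congr rfl fun p _ => Finset.sum_congr rfl fun j _ => ?_
        rw [Finset.mul_sum]
        exact Finset.sum_congr rfl fun i _ => by ring

/-- Expanding the indexing vectors in a basis turns a family indexed by pairs of vectors into a
finite matrix. Linearity of `h` matches the two forms. -/
lemma quad_basis_eq_pairing {ι : Type*} (b : Module.Basis ι ℂ K) (s : Finset ι)
    (X : K × K →₀ V)
    (hs : ∀ p ∈ X.support, (b.repr p.1).support ⊆ s ∧ (b.repr p.2).support ⊆ s)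
    (α : V →ₗ[ℂ] (L →L[ℂ] L)) (h : K →ₗ[ℂ] L) :
    quad (fun i j : s => α (∑ p ∈ X.support,
      (starRingEnd ℂ (b.repr p.1 i) * b.repr p.2 j) • X p)) (fun i => h (b i))
      = pairing α h X := by
  have hsum : ∀ ξ : K, (b.repr ξ).support ⊆ s → h ξ = ∑ i : s, b.repr ξ i • h (b i) := by
    intro ξ hξ
    conv_lhs => rw [← b.linearCombination_repr ξ]
    rw [Finsupp.linearCombination_apply, Finsupp.sum_of_support_subset _ hξ _ (by simp), map_sum,
      ← Finset.sum_coe_sort]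
    simp
  rw [quad_sum_smul X.support (fun p (i : s) => b.repr p.1 i) (fun p (i : s) => b.repr p.2 i) X,
    pairing_apply]
  refine Finset.sum_congr rfl fun p hp => ?_
  rw [← hsum p.1 (hs p hp).1, ← hsum p.2 (hs p hp).2]

/-- Arbitrary vectors assigned to basis elements extend to a linear map `K → H`. Positivity at every
such map is therefore positivity of the `π`-form of the basis matrix. -/
lemma CPDom.re_pairing_nonneg {π : V →ₗ[ℂ] (H →L[ℂ] H)} {ρ : V →ₗ[ℂ] (K →L[ℂ] K)}
    (hπρ : CPDom π ρ) (X : K × K →₀ V) (hX : ∀ h : K →ₗ[ℂ] H, 0 ≤ (pairing π h X).re) :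
    0 ≤ (pairing ρ id X).re := by
  classical
  let b := Module.Basis.ofVectorSpace ℂ K
  let s := X.support.biUnion fun p => (b.repr p.1).support ∪ (b.repr p.2).support
  have hs : ∀ p ∈ X.support, (b.repr p.1).support ⊆ s ∧ (b.repr p.2).support ⊆ s := by
    intro p hp
    exact ⟨Finset.subset_union_left.trans (Finset.subset_biUnion_of_mem
        (fun p : K × K => (b.repr p.1).support ∪ (b.repr p.2).support) hp),
      Finset.subset_union_right.trans (Finset.subset_biUnion_of_mem
        (fun p : K × K => (b.repr p.1).support ∪ (b.repr p.2).support) hp)⟩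
  have h1 := hπρ.re_nonneg (fun i j : s => ∑ p ∈ X.support,
    (starRingEnd ℂ (b.repr p.1 i) * b.repr p.2 j) • X p) (fun η => ?_) (fun i => b i)
  · have h2 := quad_basis_eq_pairing b s X hs ρ LinearMap.id
    simp only [LinearMap.id_coe, id_eq] at h2
    rwa [h2] at h1
  · have h2 := quad_basis_eq_pairing b s X hs π
      (b.constr ℂ fun i => if hi : i ∈ s then η ⟨i, hi⟩ else 0)
    simp only [Module.Basis.constr_basis, Subtype.coe_eta, Finset.coe_mem, dite_true] at h2
    rw [h2]
    exact hX _

/-- The cone of families whose form has nonnegative real part at every linear map. -/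
def pairingCone (H K : Type*) [NormedAddCommGroup H] [InnerProductSpace ℂ H]
    [NormedAddCommGroup K] [InnerProductSpace ℂ K] : PointedCone ℝ (K × K →₀ (H →L[ℂ] H)) where
  carrier := {X | ∀ h : K →ₗ[ℂ] H, 0 ≤ (pairing LinearMap.id h X).re}
  add_mem' := fun {X Y} hX hY h => by
    rw [map_add, Complex.add_re]
    exact add_nonneg (hX h) (hY h)
  zero_mem' := fun h => by simp
  smul_mem' := fun c X hX h => by
    have : c • X = ((c : ℝ) : ℂ) • X := by
      rw [Complex.coe_smul]; rfl
    rw [this, map_smul, smul_eq_mul, Complex.re_ofReal_mul]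
    exact mul_nonneg c.2 (hX h)

/-- The real part of the `ρ`-pairing is a functional on the families with entries in the range of
`π`, nonnegative on the cone. It is extended by the M. Riesz theorem and then complexified. The
family at pairs of vectors encodes all matrix coefficients of the future extension at once. -/
lemma CPDom.exists_pairing_extension {π : V →ₗ[ℂ] (H →L[ℂ] H)} (hπ : Function.Injective π)
    {ρ : V →ₗ[ℂ] (K →L[ℂ] K)} (hπρ : CPDom π ρ) {e : V} (hπe : π e = 1) :
    ∃ G : (K × K →₀ (H →L[ℂ] H)) →ₗ[ℂ] ℂ,
      (∀ X, G (Finsupp.mapRange.linearMap π X) = pairing ρ id X) ∧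
      ∀ X ∈ pairingCone H K, 0 ≤ (G X).re := by
  let R : (K × K →₀ V) →ₗ[ℂ] (K × K →₀ (H →L[ℂ] H)) := Finsupp.mapRange.linearMap π
  have hR : Function.Injective R := Finsupp.mapRange_injective _ (map_zero π) hπ
  let eR := LinearEquiv.ofInjective R hR
  let f0 : LinearMap.range R →ₗ[ℝ] ℝ :=
    Complex.reLm ∘ₗ (pairing ρ id ∘ₗ eR.symm.toLinearMap).restrictScalars ℝ
  let f : (K × K →₀ (H →L[ℂ] H)) →ₗ.[ℝ] ℝ := ⟨(LinearMap.range R).restrictScalars ℝ, f0⟩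
  have hf : ∀ X (hX : R X ∈ f.domain), f ⟨R X, hX⟩ = (pairing ρ id X).re := by
    intro X hX
    have : eR.symm ⟨R X, hX⟩ = X := by
      rw [LinearEquiv.symm_apply_eq]; rfl
    change (pairing ρ id (eR.symm ⟨R X, hX⟩)).re = _
    rw [this]
  have hnonneg : ∀ x : f.domain, (x : K × K →₀ (H →L[ℂ] H)) ∈ pairingCone H K → 0 ≤ f x := by
    rintro ⟨_, ⟨X, rfl⟩⟩ hx
    refine (hπρ.re_pairing_nonneg X fun h => ?_).trans_eq (hf X ⟨X, rfl⟩).symm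
    rw [← pairing_mapRange]
    exact hx h
  -- A single entry T at (ξ, η) is absorbed by ‖T‖ times the unit at (ξ, ξ) and at (η, η), by
  -- Cauchy–Schwarz.
  have hdense : ∀ y : K × K →₀ (H →L[ℂ] H), ∃ x : f.domain,
      (x : K × K →₀ (H →L[ℂ] H)) + y ∈ pairingCone H K := by
    intro y
    induction y using Finsupp.induction_linear with
    | zero => exact ⟨0, by simp⟩
    | add y z hy hz =>
      obtain ⟨x, hx⟩ := hy
      obtain ⟨x', hx'⟩ := hz
      refine ⟨x + x', ?_⟩
      have := add_mem hx hx'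
      rwa [add_add_add_comm] at this
    | single p T =>
      obtain ⟨ξ, η⟩ := p
      refine ⟨⟨R (Finsupp.single (ξ, ξ) ((‖T‖ : ℂ) • e) + Finsupp.single (η, η) ((‖T‖ : ℂ) • e)),
        ⟨_, rfl⟩⟩, fun h => ?_⟩
      change 0 ≤ (pairing LinearMap.id h (R _ + _)).re
      rw [map_add, pairing_mapRange, map_add, pairing_single, pairing_single, pairing_single]
      simp only [map_smul, hπe, smul_apply, one_apply_eq_self, inner_smul_right,
        inner_self_eq_ofReal, LinearMap.id_apply, Complex.add_re, Complex.re_ofReal_mul,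
        Complex.ofReal_re]
      have h3 : ‖inner ℂ (h ξ) (T (h η))‖ ≤ ‖h ξ‖ * (‖T‖ * ‖h η‖) :=
        (norm_inner_le_norm _ _).trans (by gcongr; exact T.le_opNorm _)
      have h4 := (abs_le.mp (Complex.abs_re_le_norm (inner ℂ (h ξ) (T (h η))))).1
      nlinarith [mul_nonneg (norm_nonneg T) (sq_nonneg (‖h ξ‖ - ‖h η‖)),
        mul_nonneg (norm_nonneg T) (sq_nonneg (‖h ξ‖ + ‖h η‖))]
  obtain ⟨g, hg1, hg2⟩ := riesz_extension (pairingCone H K) f hnonneg hdense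
  · refine ⟨Module.Dual.extendRCLike (𝕜 := ℂ) g, fun X => ?_, fun X hX => ?_⟩
    · have h1 : ∀ Y, (Module.Dual.extendRCLike (𝕜 := ℂ) g (R Y)).re = (pairing ρ id Y).re := by
        intro Y
        have h2 := Module.Dual.re_extendRCLike_apply (𝕜 := ℂ) g (R Y)
        rw [← hf Y ⟨Y, rfl⟩, ← hg1]
        exact h2
      apply Complex.ext
      · exact h1 X
      · have h2 := h1 (Complex.I • X)
        rw [map_smul, map_smul, map_smul] at h2
        simp only [smul_eq_mul, Complex.I_mul_re, neg_inj] at h2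
        exact h2
    · have h2 := Module.Dual.re_extendRCLike_apply (𝕜 := ℂ) g X
      exact (hg2 X hX).trans_eq h2.symm

/-- **Arveson's extension theorem**, for maps which are completely positive relative to a faithful
one. -/
theorem CPDom.exists_arveson_extension [CompleteSpace K] {π : V →ₗ[ℂ] (H →L[ℂ] H)}
    (hπ : Function.Injective π) {ρ : V →ₗ[ℂ] (K →L[ℂ] K)} (hπρ : CPDom π ρ) {e : V}
    (hπe : π e = 1) (hρe : ρ e = 1) :
    ∃ E : (H →L[ℂ] H) →ₗ[ℂ] (K →L[ℂ] K), (∀ v, E (π v) = ρ v) ∧ CPDom LinearMap.id E := by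
  obtain ⟨G, hG, hpos⟩ := hπρ.exists_pairing_extension hπ hπe
  -- If all pairings of X vanish, every complex multiple of X lies in the cone, which forces `G X =
  -- 0`. So `G` depends only on the pairings and inherits their sesquilinearity.
  have hzero : ∀ X, (∀ h : K →ₗ[ℂ] H, pairing LinearMap.id h X = 0) → G X = 0 := by
    intro X hX
    have h1 : ∀ c : ℂ, 0 ≤ (c * G X).re := by
      intro c
      rw [← smul_eq_mul, ← map_smul]
      refine hpos _ fun h => ?_
      rw [map_smul, hX]; simp
    have h2 := h1 (-starRingEnd ℂ (G X))
    rw [neg_mul, ← Complex.normSq_eq_conj_mul_self, Complex.neg_re, Complex.ofReal_re] at h2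
    exact Complex.normSq_eq_zero.mp (le_antisymm (by linarith) (Complex.normSq_nonneg _))
  have heq : ∀ X Y, (∀ h : K →ₗ[ℂ] H, pairing LinearMap.id h X = pairing LinearMap.id h Y) →
      G X = G Y := by
    intro X Y h
    rw [← sub_eq_zero, ← map_sub]
    exact hzero _ fun k => by rw [map_sub, h, sub_self]
  have hone : ∀ ξ, G (Finsupp.single (ξ, ξ) 1) = ((‖ξ‖ ^ 2 : ℝ) : ℂ) := by
    intro ξ
    have h1 := hG (Finsupp.single (ξ, ξ) e)
    rw [pairing_single, hρe] at h1
    simpa [hπe, inner_self_eq_ofReal] using h1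
  have hsmul : ∀ (c d : ℂ) (ξ η : K) (T : H →L[ℂ] H),
      G (Finsupp.single (c • ξ, d • η) T) = starRingEnd ℂ c * d * G (Finsupp.single (ξ, η) T) := by
    intro c d ξ η T
    rw [← smul_eq_mul, ← map_smul]
    refine heq _ _ fun h => ?_
    rw [map_smul, pairing_single, pairing_single, map_smul, map_smul, LinearMap.id_apply, map_smul,
      inner_smul_left, inner_smul_right, smul_eq_mul]
    ring
  have hbound0 : ∀ (T : H →L[ℂ] H) (ξ η : K),
      2 * ‖G (Finsupp.single (ξ, η) T)‖ ≤ ‖T‖ * (‖ξ‖ ^ 2 + ‖η‖ ^ 2) := by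
    intro T ξ η
    have key : ∀ c : ℂ, ‖c‖ = 1 →
        0 ≤ ‖T‖ * (‖ξ‖ ^ 2 + ‖η‖ ^ 2) + 2 * (c * G (Finsupp.single (ξ, η) T)).re := by
      intro c hc
      have h1 := hpos ((‖T‖ : ℂ) • Finsupp.single (ξ, ξ) 1 + (‖T‖ : ℂ) • Finsupp.single (η, η) 1
        + (2 : ℝ) • c • Finsupp.single (ξ, η) T) fun h => ?_
      · rw [← Complex.coe_smul] at h1
        simp only [map_add, map_smul, hone, smul_eq_mul, Complex.add_re, Complex.re_ofReal_mul,
          Complex.ofReal_re] at h1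
        linarith
      · rw [← Complex.coe_smul]
        simp only [map_add, map_smul, pairing_single, smul_eq_mul, Complex.add_re,
          Complex.re_ofReal_mul, Complex.ofReal_re, LinearMap.id_apply, one_apply_eq_self,
          inner_self_eq_ofReal]
        have h3 : ‖c * inner ℂ (h ξ) (T (h η))‖ ≤ ‖h ξ‖ * (‖T‖ * ‖h η‖) := by
          rw [norm_mul, hc, one_mul]
          exact (norm_inner_le_norm _ _).trans (by gcongr; exact T.le_opNorm _)
        have h4 := (abs_le.mp (Complex.abs_re_le_norm (c * inner ℂ (h ξ) (T (h η))))).1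
        nlinarith [mul_nonneg (norm_nonneg T) (sq_nonneg (‖h ξ‖ - ‖h η‖))]
    set z := G (Finsupp.single (ξ, η) T) with hz
    rcases eq_or_ne z 0 with h0 | h0
    · rw [h0]; simp; positivity
    have h1 := key (-(starRingEnd ℂ z / (‖z‖ : ℂ))) (by
      rw [norm_neg, norm_div, RCLike.norm_conj, Complex.norm_real, norm_norm,
        div_self (norm_ne_zero_iff.mpr h0)])
    have h2 : -(starRingEnd ℂ z / (‖z‖ : ℂ)) * z = ((-‖z‖ : ℝ) : ℂ) := by
      have h3 : (‖z‖ : ℂ) ≠ 0 := by simpa using h0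
      rw [neg_mul, div_mul_eq_mul_div, Complex.conj_mul']
      push_cast
      field_simp
    rw [h2, Complex.ofReal_re] at h1
    linarith
  have hbound : ∀ (T : H →L[ℂ] H) (ξ η : K),
      ‖G (Finsupp.single (ξ, η) T)‖ ≤ ‖T‖ * ‖ξ‖ * ‖η‖ := by
    intro T ξ η
    rcases eq_or_ne ξ 0 with rfl | hξ
    · have := hsmul 0 1 0 η T
      rw [zero_smul, one_smul, map_zero, zero_mul, zero_mul] at this
      rw [this]; simp
    rcases eq_or_ne η 0 with rfl | hη
    · have := hsmul 1 0 ξ 0 T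
      rw [zero_smul, one_smul, mul_zero, zero_mul] at this
      rw [this]; simp
    have hξ' := norm_pos_iff.mpr hξ
    have hη' := norm_pos_iff.mpr hη
    -- Rescaling both vectors to the norm ‖ξ‖ ‖η‖ turns the bound by a sum of squares into a bound
    -- by the product of norms.
    have h1 := hbound0 T ((‖η‖ : ℂ) • ξ) ((‖ξ‖ : ℂ) • η)
    rw [hsmul, norm_mul, norm_mul, RCLike.norm_conj, norm_smul, norm_smul, Complex.norm_real,
      Complex.norm_real, norm_norm, norm_norm] at h1
    have h2 : (‖η‖ * ‖ξ‖) * ‖G (Finsupp.single (ξ, η) T)‖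
        ≤ (‖η‖ * ‖ξ‖) * (‖T‖ * ‖ξ‖ * ‖η‖) := by nlinarith
    exact le_of_mul_le_mul_left h2 (by positivity)
  -- For fixed T the values of `G` form a bounded sesquilinear form on K, hence come from an
  -- operator.
  have hex : ∀ T : H →L[ℂ] H, ∃ S : K →L[ℂ] K, ∀ ξ η,
      inner ℂ ξ (S η) = G (Finsupp.single (ξ, η) T) := by
    intro T
    let B : K →ₗ⋆[ℂ] K →ₗ[ℂ] ℂ := LinearMap.mk₂'ₛₗ (starRingEnd ℂ) (RingHom.id ℂ)
      (fun ξ η => G (Finsupp.single (ξ, η) T))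
      (fun ξ ξ' η => by
        rw [← map_add]
        refine heq _ _ fun h => ?_
        simp only [map_add, pairing_single, inner_add_left])
      (fun c ξ η => by simpa using hsmul c 1 ξ η T)
      (fun ξ η η' => by
        rw [← map_add]
        refine heq _ _ fun h => ?_
        simp only [map_add, pairing_single, LinearMap.id_apply, inner_add_right])
      (fun c ξ η => by simpa using hsmul 1 c ξ η T)
    let B' : K →L⋆[ℂ] K →L[ℂ] ℂ := B.mkContinuous₂ ‖T‖ (hbound T)
    refine ⟨ContinuousLinearMap.adjoint (InnerProductSpace.continuousLinearMapOfBilin B'),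
      fun ξ η => ?_⟩
    rw [ContinuousLinearMap.adjoint_inner_right,
      InnerProductSpace.continuousLinearMapOfBilin_apply]
    rfl
  choose E0 hE0 using hex
  let E : (H →L[ℂ] H) →ₗ[ℂ] (K →L[ℂ] K) :=
    { toFun := E0
      map_add' := fun S T => by
        ext η
        refine ext_inner_left ℂ fun ξ => ?_
        rw [add_apply, inner_add_right, hE0, hE0, hE0, Finsupp.single_add, map_add]
      map_smul' := fun c T => by
        ext η
        refine ext_inner_left ℂ fun ξ => ?_
        rw [RingHom.id_apply, smul_apply, inner_smul_right, hE0, hE0, ← Finsupp.smul_single,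
          map_smul, smul_eq_mul] }
  have hE : ∀ T ξ η, inner ℂ ξ (E T η) = G (Finsupp.single (ξ, η) T) := hE0
  refine ⟨E, fun v => ?_, fun n M hM ξ => ?_⟩
  · ext η
    refine ext_inner_left ℂ fun ξ => ?_
    have h1 := hG (Finsupp.single (ξ, η) v)
    rw [pairing_single] at h1
    simpa [hE] using h1
  · have h1 : quad (fun i j => E (M i j)) ξ
        = G (∑ i, ∑ j, Finsupp.single (ξ i, ξ j) (M i j)) := by
      simp only [quad, hE, map_sum]
    rw [h1]
    refine hpos _ fun h => ?_
    have h2 := hM (fun i => h (ξ i))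
    simpa only [map_sum, pairing_single, quad] using h2

end Arveson

/-! ### Completely positive maps on the minimal tensor product. -/

section MinTensorMaps

variable {A₁ A₂ H₁ H₂ L₁ L₂ : Type*} [CStarAlgebra A₁] [CStarAlgebra A₂]
  [NormedAddCommGroup H₁] [InnerProductSpace ℂ H₁] [CompleteSpace H₁]
  [NormedAddCommGroup H₂] [InnerProductSpace ℂ H₂] [CompleteSpace H₂]
  [NormedAddCommGroup L₁] [InnerProductSpace ℂ L₁]
  [NormedAddCommGroup L₂] [InnerProductSpace ℂ L₂]
  (π₁ : A₁ →⋆ₐ[ℂ] (H₁ →L[ℂ] H₁)) (π₂ : A₂ →⋆ₐ[ℂ] (H₂ →L[ℂ] H₂))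

namespace MinTensor

lemma incl_injective : Function.Injective (incl π₁ π₂) := Subtype.val_injective

@[simp] lemma incl_tmul (x : A₁) (y : A₂) :
    incl π₁ π₂ (tmul π₁ π₂ x y) = tensorOp (π₁ x) (π₂ y) := rfl

lemma norm_incl (x : MinTensor π₁ π₂) : ‖incl π₁ π₂ x‖ = ‖x‖ := rfl

lemma tmul_one_one : tmul π₁ π₂ 1 1 = 1 :=
  incl_injective π₁ π₂ (by rw [incl_tmul, map_one, map_one, map_one, tensorOp_one])

/-- The map from the algebraic to the minimal tensor product. -/
noncomputable def ofTensor : (A₁ ⊗[ℂ] A₂) →ₗ[ℂ] MinTensor π₁ π₂ :=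
  TensorProduct.lift (LinearMap.mk₂ ℂ (tmul π₁ π₂)
    (fun _ _ _ => incl_injective π₁ π₂ (by simp [tensorOp_add_left]))
    (fun _ _ _ => incl_injective π₁ π₂ (by simp [tensorOp_smul_left]))
    (fun _ _ _ => incl_injective π₁ π₂ (by simp [tensorOp_add_right]))
    (fun _ _ _ => incl_injective π₁ π₂ (by simp [tensorOp_smul_right])))

@[simp] lemma ofTensor_tmul (x : A₁) (y : A₂) : ofTensor π₁ π₂ (x ⊗ₜ y) = tmul π₁ π₂ x y := rfl

lemma repLin_incl_comp_ofTensor :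
    repLin (incl π₁ π₂) ∘ₗ ofTensor π₁ π₂ = tensorLin (repLin π₁) (repLin π₂) :=
  TensorProduct.ext' fun _ _ => rfl

lemma incl_ofTensor (z : A₁ ⊗[ℂ] A₂) :
    incl π₁ π₂ (ofTensor π₁ π₂ z) = tensorLin (repLin π₁) (repLin π₂) z :=
  LinearMap.congr_fun (repLin_incl_comp_ofTensor π₁ π₂) z

lemma tensorLin_mul (z w : A₁ ⊗[ℂ] A₂) : tensorLin (repLin π₁) (repLin π₂) (z * w)
    = tensorLin (repLin π₁) (repLin π₂) z * tensorLin (repLin π₁) (repLin π₂) w := by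
  induction z with
  | zero => simp
  | add a b ha hb => rw [add_mul, map_add, ha, hb, map_add, add_mul]
  | tmul x y =>
    induction w with
    | zero => simp
    | add a b ha hb => rw [mul_add, map_add, ha, hb, map_add, mul_add]
    | tmul x' y' => simp [tensorOp_mul]

lemma exists_tensorLin_eq_star (z : A₁ ⊗[ℂ] A₂) : ∃ w, tensorLin (repLin π₁) (repLin π₂) w
    = star (tensorLin (repLin π₁) (repLin π₂) z) := by
  induction z with
  | zero => exact ⟨0, by simp⟩
  | add a b ha hb =>
    obtain ⟨v, hv⟩ := ha
    obtain ⟨w, hw⟩ := hb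
    exact ⟨v + w, by rw [map_add, hv, hw, map_add, star_add]⟩
  | tmul x y => exact ⟨star x ⊗ₜ star y, by simp [tensorOp_star, map_star]⟩

lemma exists_tensorLin_eq_of_mem_adjoin {T : HilbertTensor H₁ H₂ →L[ℂ] HilbertTensor H₁ H₂}
    (hT : T ∈ StarAlgebra.adjoin ℂ {T | ∃ x y, T = tensorOp (π₁ x) (π₂ y)}) :
    ∃ z, tensorLin (repLin π₁) (repLin π₂) z = T := by
  induction hT using StarAlgebra.adjoin_induction with
  | mem T h =>
    obtain ⟨x, y, rfl⟩ := h
    exact ⟨x ⊗ₜ y, rfl⟩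
  | algebraMap r =>
    refine ⟨r • ((1 : A₁) ⊗ₜ[ℂ] (1 : A₂)), ?_⟩
    rw [map_smul, tensorLin_tmul, repLin_apply, repLin_apply, map_one, map_one, tensorOp_one,
      Algebra.algebraMap_eq_smul_one]
  | add S T _ _ hS hT =>
    obtain ⟨v, rfl⟩ := hS
    obtain ⟨w, rfl⟩ := hT
    exact ⟨v + w, map_add _ _ _⟩
  | mul S T _ _ hS hT =>
    obtain ⟨v, rfl⟩ := hS
    obtain ⟨w, rfl⟩ := hT
    exact ⟨v * w, tensorLin_mul π₁ π₂ v w⟩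
  | star S _ hS =>
    obtain ⟨v, rfl⟩ := hS
    exact exists_tensorLin_eq_star π₁ π₂ v

/-- Sums of elementary tensors are already closed under products and adjoints, so they exhaust the
algebraic star subalgebra whose closure is taken. -/
lemma denseRange_ofTensor : DenseRange (ofTensor π₁ π₂) := by
  intro x
  rw [Metric.mem_closure_iff]
  intro ε hε
  have hx : incl π₁ π₂ x ∈ closure ((StarAlgebra.adjoin ℂ {T | ∃ x y, T = tensorOp (π₁ x) (π₂ y)} :
      StarSubalgebra ℂ (HilbertTensor H₁ H₂ →L[ℂ] HilbertTensor H₁ H₂)) :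
      Set (HilbertTensor H₁ H₂ →L[ℂ] HilbertTensor H₁ H₂)) := x.2
  obtain ⟨T, hT, hd⟩ := Metric.mem_closure_iff.mp hx ε hε
  obtain ⟨z, rfl⟩ := exists_tensorLin_eq_of_mem_adjoin π₁ π₂ hT
  refine ⟨ofTensor π₁ π₂ z, ⟨z, rfl⟩, ?_⟩
  rw [dist_eq_norm, ← norm_incl, map_sub, incl_ofTensor, ← dist_eq_norm]
  exact hd

end MinTensor

open MinTensor

variable {π₁ π₂}

/-- The tensor product of two unital relatively completely positive maps, on the minimal tensor
product. -/
lemma CPDom.exists_minTensor_map {α₁ : A₁ →ₗ[ℂ] (L₁ →L[ℂ] L₁)} {α₂ : A₂ →ₗ[ℂ] (L₂ →L[ℂ] L₂)}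
    (h₁ : CPDom (repLin π₁) α₁) (h₂ : CPDom (repLin π₂) α₂) (hα₁ : α₁ 1 = 1) (hα₂ : α₂ 1 = 1) :
    ∃ Φ : MinTensor π₁ π₂ →L[ℂ] (HilbertTensor L₁ L₂ →L[ℂ] HilbertTensor L₁ L₂),
      (∀ x y, Φ (tmul π₁ π₂ x y) = tensorOp (α₁ x) (α₂ y)) ∧
      CPDom (repLin (incl π₁ π₂)) Φ.toLinearMap := by
  have h := h₁.tensor h₂
  rw [← repLin_incl_comp_ofTensor] at h
  have hn : ∀ w, ‖repLin (incl π₁ π₂) w‖ = ‖w‖ := norm_incl π₁ π₂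
  have hu : repLin (incl π₁ π₂) (ofTensor π₁ π₂ (1 ⊗ₜ 1)) = 1 := by
    rw [ofTensor_tmul, tmul_one_one, repLin_apply, map_one]
  have hα : tensorLin α₁ α₂ (1 ⊗ₜ 1) = 1 := by
    rw [tensorLin_tmul, hα₁, hα₂, tensorOp_one]
  obtain ⟨Φ, hΦ, hcp⟩ := h.exists_extension (denseRange_ofTensor π₁ π₂) hn hu hα
  exact ⟨Φ, fun x y => hΦ (x ⊗ₜ y), hcp⟩

lemma minTensor_clm_ext {E : Type*} [NormedAddCommGroup E] [NormedSpace ℂ E]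
    {Φ Ψ : MinTensor π₁ π₂ → E} (hΦ : IsLinearMap ℂ Φ) (hΨ : IsLinearMap ℂ Ψ)
    (hΦc : Continuous Φ) (hΨc : Continuous Ψ)
    (h : ∀ x y, Φ (tmul π₁ π₂ x y) = Ψ (tmul π₁ π₂ x y)) : Φ = Ψ := by
  refine (denseRange_ofTensor π₁ π₂).equalizer hΦc hΨc ?_
  ext z
  have : hΦ.mk' Φ ∘ₗ ofTensor π₁ π₂ = hΨ.mk' Ψ ∘ₗ ofTensor π₁ π₂ := TensorProduct.ext' h
  exact LinearMap.congr_fun this z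

/-- Completely positive maps are automatically continuous, and elementary tensors span a dense
subspace. -/
lemma minTensor_cp_ext {θ θ' : CompletelyPositiveMap (MinTensor π₁ π₂) (MinTensor π₁ π₂)}
    (h : ∀ x y, θ (tmul π₁ π₂ x y) = θ' (tmul π₁ π₂ x y)) : θ = θ' := by
  refine DFunLike.coe_injective (minTensor_clm_ext ⟨map_add θ, map_smul θ⟩ ⟨map_add θ', map_smul θ'⟩
    (map_continuous θ) (map_continuous θ') h)

variable [PartialOrder A₁] [StarOrderedRing A₁] [PartialOrder A₂] [StarOrderedRing A₂]

theorem exists_minTensor_cp (hπ₁ : Function.Injective π₁) (hπ₂ : Function.Injective π₂)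
    (θ₁ : CompletelyPositiveMap A₁ A₁) (hθ₁ : θ₁ 1 = 1)
    (θ₂ : CompletelyPositiveMap A₂ A₂) (hθ₂ : θ₂ 1 = 1) :
    ∃ θ : CompletelyPositiveMap (MinTensor π₁ π₂) (MinTensor π₁ π₂),
      ∀ x y, θ (tmul π₁ π₂ x y) = tmul π₁ π₂ (θ₁ x) (θ₂ y) := by
  obtain ⟨Φ, hΦ, hcp⟩ := CPDom.exists_minTensor_map
    (CompletelyPositiveMap.cpDom θ₁ π₁ hπ₁ π₁) (CompletelyPositiveMap.cpDom θ₂ π₂ hπ₂ π₂)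
    (by change π₁ (θ₁ 1) = 1; rw [hθ₁, map_one]) (by change π₂ (θ₂ 1) = 1; rw [hθ₂, map_one])
  -- `Φ` takes values in all bounded operators. It sends elementary tensors into the minimal tensor
  -- product, which is closed, so it maps everything there.
  have hrange : ∀ z, Φ z ∈ Set.range (incl π₁ π₂) := by
    have hclosed : IsClosed (Set.range (incl π₁ π₂)) := by
      have : Set.range (incl π₁ π₂) = (minTensorSubalgebra π₁ π₂ : Set _) := Subtype.range_coe
      rw [this]
      exact StarSubalgebra.isClosed_topologicalClosure _
    intro z
    refine (denseRange_ofTensor π₁ π₂).induction_on z (hclosed.preimage Φ.continuous) fun w => ?_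
    induction w with
    | zero => exact ⟨0, by simp⟩
    | tmul x y => exact ⟨tmul π₁ π₂ (θ₁ x) (θ₂ y), (hΦ x y).symm⟩
    | add a b ha hb =>
      obtain ⟨v, hv⟩ := ha
      obtain ⟨w, hw⟩ := hb
      exact ⟨v + w, by rw [map_add, hv, hw, map_add, map_add]⟩
  choose f hf using hrange
  let F : MinTensor π₁ π₂ →ₗ[ℂ] MinTensor π₁ π₂ :=
    { toFun := f
      map_add' := fun x y => incl_injective π₁ π₂ (by simp [hf])
      map_smul' := fun c x => incl_injective π₁ π₂ (by simp [hf]) }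
  have hF : repLin (incl π₁ π₂) ∘ₗ F = Φ.toLinearMap := LinearMap.ext hf
  rw [← hF] at hcp
  refine ⟨hcp.toCP (incl π₁ π₂) (incl_injective π₁ π₂), fun x y => incl_injective π₁ π₂ ?_⟩
  exact (hf _).trans (hΦ x y)

end MinTensorMaps

/-! ### Tensor products and compressions of finite-dimensional algebras. -/

namespace FinDimData

/-- The tensor product of two finite-dimensional C⋆-algebras. -/
def tensor (B C : FinDimData) : FinDimData where
  ι := B.ι × C.ι
  n := fun p => B.n p.1 × C.n p.2

variable (B C : FinDimData)

/-- The Hilbert space of the standard representation. -/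
abbrev Space : Type := EuclideanSpace ℂ (Σ i, B.n i)

open Classical in
/-- The block diagonal representation as a map into matrices. -/
noncomputable def toMatrix : B.Alg →⋆ₐ[ℂ] Matrix (Σ i, B.n i) (Σ i, B.n i) ℂ where
  toFun x := Matrix.blockDiagonal' fun i => CStarMatrix.ofMatrix.symm (x i)
  map_one' := Matrix.blockDiagonal'_one
  map_mul' x y := Matrix.blockDiagonal'_mul
    (fun i => CStarMatrix.ofMatrix.symm (x i)) (fun i => CStarMatrix.ofMatrix.symm (y i))
  map_zero' := Matrix.blockDiagonal'_zero
  map_add' x y := Matrix.blockDiagonal'_add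
    (fun i => CStarMatrix.ofMatrix.symm (x i)) (fun i => CStarMatrix.ofMatrix.symm (y i))
  commutes' c := by
    rw [Algebra.algebraMap_eq_smul_one, Algebra.algebraMap_eq_smul_one,
      ← Matrix.blockDiagonal'_one (m' := B.n) (α := ℂ), ← Matrix.blockDiagonal'_smul]
    rfl
  map_star' x := (Matrix.blockDiagonal'_conjTranspose
    (fun i => CStarMatrix.ofMatrix.symm (x i))).symm

open Classical in
/-- The standard faithful representation. -/
noncomputable def rep : B.Alg →⋆ₐ[ℂ] (B.Space →L[ℂ] B.Space) :=
  (Matrix.toEuclideanCLM (𝕜 := ℂ) (n := Σ i, B.n i) : _ →⋆ₐ[ℂ] _).comp B.toMatrix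

variable {B C}

lemma inner_rep (x : B.Alg) (ξ η : B.Space) :
    inner ℂ ξ (B.rep x η) = ∑ i, ∑ p, ∑ q, starRingEnd ℂ (ξ ⟨i, p⟩) * x i p q * η ⟨i, q⟩ := by
  classical
  have h : ∀ i p, B.rep x η ⟨i, p⟩ = ∑ q, x i p q * η ⟨i, q⟩ := by
    intro i p
    change (Matrix.mulVec (Matrix.blockDiagonal' fun i => CStarMatrix.ofMatrix.symm (x i))
      (WithLp.ofLp η)) ⟨i, p⟩ = _
    rw [Matrix.mulVec, dotProduct, Fintype.sum_sigma, Finset.sum_eq_single i]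
    · exact Finset.sum_congr rfl fun q _ => by rw [Matrix.blockDiagonal'_apply_eq]; rfl
    · intro j _ hj
      exact Finset.sum_eq_zero fun q _ => by
        rw [Matrix.blockDiagonal'_apply_ne _ _ _ (Ne.symm hj), zero_mul]
    · simp
  rw [PiLp.inner_apply, Fintype.sum_sigma]
  refine Finset.sum_congr rfl fun i _ => Finset.sum_congr rfl fun p _ => ?_
  rw [h, RCLike.inner_apply, Finset.sum_mul]
  exact Finset.sum_congr rfl fun q _ => by ring

/-- The standard basis vector. -/
noncomputable def basisVec (i : B.ι) (p : B.n i) : B.Space := by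
  classical exact EuclideanSpace.single ⟨i, p⟩ 1

lemma inner_basisVec_rep (x : B.Alg) (i : B.ι) (p q : B.n i) :
    inner ℂ (basisVec i p) (B.rep x (basisVec i q)) = x i p q := by
  classical
  have h : ∀ j r, basisVec (B := B) i q ⟨j, r⟩ = if (⟨j, r⟩ : Σ i, B.n i) = ⟨i, q⟩ then 1 else 0 := by
    intro j r
    simp only [basisVec, PiLp.single_apply]
  have h' : ∀ j r, basisVec (B := B) i p ⟨j, r⟩ = if (⟨j, r⟩ : Σ i, B.n i) = ⟨i, p⟩ then 1 else 0 := by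
    intro j r
    simp only [basisVec, PiLp.single_apply]
  rw [inner_rep, Finset.sum_eq_single i, Finset.sum_eq_single p, Finset.sum_eq_single q]
  · simp [h, h']
  · intro r _ hr; simp [h, hr]
  · simp
  · intro r _ hr; simp [h', hr]
  · simp
  · intro j _ hj
    refine Finset.sum_eq_zero fun r _ => Finset.sum_eq_zero fun r' _ => ?_
    rw [h', if_neg (fun hh => hj (congrArg Sigma.fst hh))]
    simp
  · simp

lemma rep_injective : Function.Injective B.rep := by
  intro x y h
  ext i p q
  rw [← inner_basisVec_rep x, h, inner_basisVec_rep]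

/-- The Kronecker product of two elements. -/
noncomputable def kron (x : B.Alg) (y : C.Alg) : (B.tensor C).Alg := fun k =>
  CStarMatrix.ofMatrix (Matrix.of fun p q => x k.1 p.1 q.1 * y k.2 p.2 q.2)

lemma tensor_alg_ext {x y : (B.tensor C).Alg}
    (h : ∀ (i : B.ι) (j : C.ι) (p p' : B.n i) (q q' : C.n j),
      x (i, j) (p, q) (p', q') = y (i, j) (p, q) (p', q')) : x = y := by
  ext ⟨i, j⟩ ⟨p, q⟩ ⟨p', q'⟩
  exact h i j p p' q q'

/-- The Kronecker product as a linear map. -/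
noncomputable def kronLin : (B.Alg ⊗[ℂ] C.Alg) →ₗ[ℂ] (B.tensor C).Alg :=
  TensorProduct.lift (LinearMap.mk₂ ℂ kron
    (fun x x' y => tensor_alg_ext fun i j p p' q q' => add_mul (x i p p') (x' i p p') (y j q q'))
    (fun c x y => tensor_alg_ext fun i j p p' q q' => mul_assoc c (x i p p') (y j q q'))
    (fun x y y' => tensor_alg_ext fun i j p p' q q' => mul_add (x i p p') (y j q q') (y' j q q'))
    (fun c x y => tensor_alg_ext fun i j p p' q q' => mul_left_comm (x i p p') c (y j q q')))

@[simp] lemma kronLin_tmul (x : B.Alg) (y : C.Alg) : kronLin (x ⊗ₜ[ℂ] y) = kron x y := rfl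

lemma kron_one_one : kron (1 : B.Alg) (1 : C.Alg) = 1 := by
  refine tensor_alg_ext fun i j p p' q q' => ?_
  change (1 : CStarMatrix (B.n i) (B.n i) ℂ) p p' * (1 : CStarMatrix (C.n j) (C.n j) ℂ) q q'
    = (1 : CStarMatrix (B.n i × C.n j) (B.n i × C.n j) ℂ) (p, q) (p', q')
  rw [CStarMatrix.one_apply, CStarMatrix.one_apply, CStarMatrix.one_apply]
  by_cases hp : p = p' <;> by_cases hq : q = q' <;> simp [hp, hq]

open Classical in
/-- A matrix unit. -/
noncomputable def unit (i : B.ι) (p q : B.n i) : B.Alg := fun j =>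
  CStarMatrix.ofMatrix (Matrix.of fun r s =>
    if (⟨j, r, s⟩ : Σ i, B.n i × B.n i) = ⟨i, p, q⟩ then 1 else 0)

open Classical in
lemma unit_apply (i j : B.ι) (p q : B.n i) (r s : B.n j) : unit i p q j r s
    = if (⟨j, r, s⟩ : Σ i, B.n i × B.n i) = ⟨i, p, q⟩ then 1 else 0 := rfl

/-- Matrix units of the tensor product are Kronecker products of matrix units. Surjectivity serves
as the density needed to extend maps from the algebraic tensor product. -/
lemma kronLin_surjective : Function.Surjective (kronLin (B := B) (C := C)) := by
  classical
  intro x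
  refine ⟨∑ P : Σ i, B.n i × B.n i, ∑ Q : Σ j, C.n j × C.n j,
    x (P.1, Q.1) (P.2.1, Q.2.1) (P.2.2, Q.2.2) • (unit P.1 P.2.1 P.2.2 ⊗ₜ unit Q.1 Q.2.1 Q.2.2), ?_⟩
  refine tensor_alg_ext fun i j p p' q q' => ?_
  have hsum : ∀ {J : Type} (s : Finset J) (f : J → (B.tensor C).Alg),
      (∑ k ∈ s, f k) (i, j) (p, q) (p', q') = ∑ k ∈ s, f k (i, j) (p, q) (p', q') := by
    intro J s f
    induction s using Finset.induction_on with
    | empty => rfl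
    | insert a s ha ih =>
      rw [Finset.sum_insert ha, Finset.sum_insert ha, ← ih]; rfl
  simp only [map_sum, map_smul, kronLin_tmul, hsum]
  have happ : ∀ (c : ℂ) (y : B.Alg) (z : C.Alg), (c • kron y z) (i, j) (p, q) (p', q')
      = c * (y i p p' * z j q q') := fun _ _ _ => rfl
  simp only [happ, unit_apply]
  rw [Finset.sum_eq_single ⟨i, p, p'⟩, Finset.sum_eq_single ⟨j, q, q'⟩]
  · simp
  · intro Q _ hQ
    rw [if_neg (c := _ = Q) (Ne.symm hQ)]; simp
  · simp
  · intro P _ hP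
    refine Finset.sum_eq_zero fun Q _ => ?_
    rw [if_neg (c := _ = P) (Ne.symm hP)]; simp
  · simp

/-- The product vector in the standard representation space of the tensor product. -/
noncomputable def prodVec (ξ : B.Space) (e : C.Space) : (B.tensor C).Space :=
  WithLp.toLp 2 fun k => ξ ⟨k.1.1, k.2.1⟩ * e ⟨k.1.2, k.2.2⟩

lemma inner_prodVec (x : B.Alg) (y : C.Alg) (ξ ξ' : B.Space) (e e' : C.Space) :
    inner ℂ (prodVec ξ e) ((B.tensor C).rep (kron x y) (prodVec ξ' e'))
      = inner ℂ ξ (B.rep x ξ') * inner ℂ e (C.rep y e') := by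
  rw [inner_rep, inner_rep, inner_rep, Finset.sum_mul_sum]
  change ∑ k : B.ι × C.ι, ∑ p : B.n k.1 × C.n k.2, ∑ q : B.n k.1 × C.n k.2,
    starRingEnd ℂ (ξ ⟨k.1, p.1⟩ * e ⟨k.2, p.2⟩) * (x k.1 p.1 q.1 * y k.2 p.2 q.2)
      * (ξ' ⟨k.1, q.1⟩ * e' ⟨k.2, q.2⟩) = _
  rw [Fintype.sum_prod_type]
  refine Finset.sum_congr rfl fun i _ => Finset.sum_congr rfl fun j _ => ?_
  rw [Fintype.sum_prod_type, Finset.sum_mul_sum]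
  refine Finset.sum_congr rfl fun p _ => Finset.sum_congr rfl fun p' _ => ?_
  rw [Fintype.sum_prod_type, Finset.sum_mul_sum]
  refine Finset.sum_congr rfl fun q _ => Finset.sum_congr rfl fun q' _ => ?_
  rw [map_mul]
  ring

lemma inner_tensorLin_rep (z : B.Alg ⊗[ℂ] C.Alg) (ξ ξ' : B.Space) (e e' : C.Space) :
    inner ℂ (toHT (ξ ⊗ₜ[ℂ] e)) (tensorLin (repLin B.rep) (repLin C.rep) z (toHT (ξ' ⊗ₜ[ℂ] e')))
      = inner ℂ (prodVec ξ e) ((B.tensor C).rep (kronLin z) (prodVec ξ' e')) := by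
  induction z with
  | zero => simp
  | tmul x y => rw [tensorLin_tmul, inner_tensorOp, kronLin_tmul, inner_prodVec]; rfl
  | add a b ha hb => simp only [map_add, add_apply, inner_add_right, ha, hb]

/-- Product vectors in the standard space and elementary tensors in the Hilbert tensor product give
the same matrix coefficients, and the latter vectors span densely. -/
lemma cpDom_rep_kron : CPDom (repLin (B.tensor C).rep ∘ₗ kronLin)
    (tensorLin (repLin B.rep) (repLin C.rep)) := by
  intro n X hX
  refine re_quad_nonneg_of_dense _ fun S => ?_
  have h2 := hX fun i => ∑ s : S i, prodVec s.1.1 s.1.2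
  rw [quad_sigma (fun i j => (repLin (B.tensor C).rep ∘ₗ kronLin) (X i j))
    (fun P : Σ i, S i => prodVec P.2.1.1 P.2.1.2)] at h2
  simp only [quad, inner_tensorLin_rep]
  exact h2

variable {V L A H : Type*} [AddCommGroup V] [Module ℂ V]
  [NormedAddCommGroup L] [InnerProductSpace ℂ L]

/-- Compression of an operator-valued map to blocks of matrix coefficients. -/
noncomputable def compress (α : V →ₗ[ℂ] (L →L[ℂ] L)) (v : ∀ i, B.n i → L) : V →ₗ[ℂ] B.Alg where
  toFun z := fun i => CStarMatrix.ofMatrix (Matrix.of fun p q => inner ℂ (v i p) (α z (v i q)))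
  map_add' x y := by
    ext i p q
    change inner ℂ (v i p) (α (x + y) (v i q))
      = inner ℂ (v i p) (α x (v i q)) + inner ℂ (v i p) (α y (v i q))
    simp
  map_smul' c x := by
    ext i p q
    change inner ℂ (v i p) (α (c • x) (v i q)) = c * inner ℂ (v i p) (α x (v i q))
    simp

lemma compress_apply (α : V →ₗ[ℂ] (L →L[ℂ] L)) (v : ∀ i, B.n i → L) (z : V) (i : B.ι)
    (p q : B.n i) : compress α v z i p q = inner ℂ (v i p) (α z (v i q)) := rfl

/-- The form of the compression is a sum, over the blocks, of forms of `α` at linear combinations of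
the chosen vectors. -/
lemma cpDom_compress (α : V →ₗ[ℂ] (L →L[ℂ] L)) (v : ∀ i, B.n i → L) :
    CPDom α (repLin B.rep ∘ₗ compress α v) := by
  intro n M hM ξ
  have h : quad (fun s t => (repLin B.rep ∘ₗ compress α v) (M s t)) ξ
      = ∑ i, quad (fun s t => α (M s t)) (fun s => ∑ p, ξ s ⟨i, p⟩ • v i p) := by
    have hst : ∀ s t, inner ℂ (ξ s) (B.rep (compress α v (M s t)) (ξ t))
        = ∑ i, inner ℂ (∑ p, ξ s ⟨i, p⟩ • v i p) (α (M s t) (∑ q, ξ t ⟨i, q⟩ • v i q)) := by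
      intro s t
      rw [inner_rep]
      refine Finset.sum_congr rfl fun i _ => ?_
      simp only [compress_apply, map_sum, map_smul, sum_inner, inner_sum, inner_smul_left,
        inner_smul_right]
      rw [Finset.sum_comm]
      refine Finset.sum_congr rfl fun q _ => ?_
      rw [Finset.mul_sum]
      exact Finset.sum_congr rfl fun p _ => by ring
    simp only [quad, LinearMap.comp_apply, repLin_apply, hst]
    exact (Finset.sum_congr rfl fun s _ => Finset.sum_comm).trans Finset.sum_comm
  rw [h, Complex.re_sum]
  exact Finset.sum_nonneg fun i _ => hM _

end FinDimData

lemma CompletelyPositiveMap.norm_apply_le {A B H L : Type*}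
    [CStarAlgebra A] [PartialOrder A] [StarOrderedRing A]
    [CStarAlgebra B] [PartialOrder B] [StarOrderedRing B]
    [NormedAddCommGroup H] [InnerProductSpace ℂ H] [CompleteSpace H]
    [NormedAddCommGroup L] [InnerProductSpace ℂ L] [CompleteSpace L]
    (φ : CompletelyPositiveMap A B) (hφ : φ 1 = 1)
    {π : A →⋆ₐ[ℂ] (H →L[ℂ] H)} (hπ : Function.Injective π)
    {σ : B →⋆ₐ[ℂ] (L →L[ℂ] L)} (hσ : Function.Injective σ) (x : A) : ‖φ x‖ ≤ ‖x‖ := by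
  have h := (CompletelyPositiveMap.cpDom φ π hπ σ).norm_le (e := 1)
    (by rw [repLin_apply, map_one])
    (by rw [LinearMap.comp_apply, repLin_apply]; exact (congrArg σ hφ).trans (map_one σ)) x
  rw [repLin_apply, NonUnitalStarAlgHom.norm_map π hπ] at h
  rw [← NonUnitalStarAlgHom.norm_map σ hσ]
  exact h

/-- The identical representation of the bounded operators. -/
noncomputable abbrev idRep (H : Type*) [NormedAddCommGroup H] [InnerProductSpace ℂ H]
    [CompleteSpace H] : (H →L[ℂ] H) →⋆ₐ[ℂ] (H →L[ℂ] H) := StarAlgHom.id ℂ _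

lemma idRep_injective (H : Type*) [NormedAddCommGroup H] [InnerProductSpace ℂ H]
    [CompleteSpace H] : Function.Injective (idRep H) := Function.injective_id

/-! ### Change of representation. -/

section Transfer

variable {A H K : Type*} [CStarAlgebra A] [PartialOrder A] [StarOrderedRing A]
  [NormedAddCommGroup H] [InnerProductSpace ℂ H] [CompleteSpace H]
  [NormedAddCommGroup K] [InnerProductSpace ℂ K] [CompleteSpace K]

/-- Completely positive approximations relative to a faithful representation yield ones relative to
any representation. -/
lemma CPA.exists_transfer {π : A →⋆ₐ[ℂ] (H →L[ℂ] H)} (hπ : Function.Injective π)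
    (ρ : A →⋆ₐ[ℂ] (K →L[ℂ] K)) {S : Set A} {δ : ℝ} (c : CPA π S δ) :
    ∃ ψ : CompletelyPositiveMap c.B.Alg (K →L[ℂ] K), ψ 1 = 1 ∧
      ∀ x ∈ S, ‖ψ (c.φ x) - ρ x‖ < δ := by
  have hρ : CPDom (repLin π) (repLin ρ) := by
    have h := CompletelyPositiveMap.cpDom
      (CompletelyPositiveMapClass.toCompletelyPositiveLinearMap ρ) π hπ (idRep K)
    exact h
  -- `E` extends ρ ∘ π⁻¹ from the image of `π` to all bounded operators. The new ψ is E ∘ ψ, and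
  -- contractivity of `E` preserves the tolerance.
  obtain ⟨E, hE, hcp⟩ := hρ.exists_arveson_extension hπ (e := 1) (map_one π) (map_one ρ)
  have hE1 : E 1 = 1 := by
    have := hE 1
    rwa [repLin_apply, repLin_apply, map_one π, map_one ρ] at this
  have h1 : CPDom (repLin c.B.rep) (repLin (idRep K) ∘ₗ (E ∘ₗ c.ψ.toLinearMap)) :=
    (CompletelyPositiveMap.cpDom c.ψ c.B.rep FinDimData.rep_injective (idRep H)).trans
      (hcp.comp c.ψ.toLinearMap)
  refine ⟨h1.toCP c.B.rep (idRep_injective K), ?_, fun x hx => ?_⟩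
  · exact (congrArg E c.ψ_one).trans hE1
  · have h2 : E (c.ψ (c.φ x) - π x) = E (c.ψ (c.φ x)) - ρ x := by
      rw [map_sub]; exact congrArg _ (hE x)
    refine lt_of_le_of_lt ?_ (c.approx x hx)
    have h3 := hcp.norm_le (e := 1) rfl hE1 (c.ψ (c.φ x) - π x)
    rw [h2] at h3
    exact h3

/-- The transfer of a completely positive approximation to another representation. -/
noncomputable def CPA.transfer {π : A →⋆ₐ[ℂ] (H →L[ℂ] H)} (hπ : Function.Injective π)
    (ρ : A →⋆ₐ[ℂ] (K →L[ℂ] K)) {S : Set A} {δ : ℝ} (c : CPA π S δ) : CPA ρ S δ where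
  B := c.B
  φ := c.φ
  ψ := (c.exists_transfer hπ ρ).choose
  φ_one := c.φ_one
  ψ_one := (c.exists_transfer hπ ρ).choose_spec.1
  approx := (c.exists_transfer hπ ρ).choose_spec.2

end Transfer

/-! ### Tensor products of the two halves of an approximation. -/

section Tensor

open MinTensor FinDimData

variable {A₁ A₂ H₁ H₂ : Type*} [CStarAlgebra A₁] [CStarAlgebra A₂]
  [PartialOrder A₁] [StarOrderedRing A₁] [PartialOrder A₂] [StarOrderedRing A₂]
  [NormedAddCommGroup H₁] [InnerProductSpace ℂ H₁] [CompleteSpace H₁]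
  [NormedAddCommGroup H₂] [InnerProductSpace ℂ H₂] [CompleteSpace H₂]
  {π₁ : A₁ →⋆ₐ[ℂ] (H₁ →L[ℂ] H₁)} {π₂ : A₂ →⋆ₐ[ℂ] (H₂ →L[ℂ] H₂)}

/-- The product map first lands in the operators on the Hilbert tensor product of the standard
spaces. Compression to products of basis vectors within each pair of blocks brings it into the
finite-dimensional algebra. -/
lemma exists_cp_to_tensor (hπ₁ : Function.Injective π₁) (hπ₂ : Function.Injective π₂)
    {B C : FinDimData} (φ₁ : CompletelyPositiveMap A₁ B.Alg) (hφ₁ : φ₁ 1 = 1)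
    (φ₂ : CompletelyPositiveMap A₂ C.Alg) (hφ₂ : φ₂ 1 = 1) :
    ∃ φ : CompletelyPositiveMap (MinTensor π₁ π₂) (B.tensor C).Alg,
      ∀ x y, φ (tmul π₁ π₂ x y) = kron (φ₁ x) (φ₂ y) := by
  obtain ⟨Φ, hΦ, hcp⟩ := CPDom.exists_minTensor_map
    (CompletelyPositiveMap.cpDom φ₁ π₁ hπ₁ B.rep) (CompletelyPositiveMap.cpDom φ₂ π₂ hπ₂ C.rep)
    ((congrArg B.rep hφ₁).trans (map_one _)) ((congrArg C.rep hφ₂).trans (map_one _))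
  let v : ∀ k : (B.tensor C).ι, (B.tensor C).n k → HilbertTensor B.Space C.Space :=
    fun k p => toHT (basisVec k.1 p.1 ⊗ₜ basisVec k.2 p.2)
  have h := hcp.trans (cpDom_compress (B := B.tensor C) Φ.toLinearMap v)
  refine ⟨h.toCP (incl π₁ π₂) rep_injective, fun x y => tensor_alg_ext fun i j p p' q q' => ?_⟩
  change inner ℂ (toHT (basisVec i p ⊗ₜ[ℂ] basisVec j q))
    (Φ (tmul π₁ π₂ x y) (toHT (basisVec i p' ⊗ₜ[ℂ] basisVec j q'))) = _
  rw [hΦ, inner_tensorOp]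
  exact congrArg₂ _ (inner_basisVec_rep (φ₁ x) i p p') (inner_basisVec_rep (φ₂ y) j q q')

lemma exists_cp_from_tensor {B C : FinDimData}
    (ψ₁ : CompletelyPositiveMap B.Alg (H₁ →L[ℂ] H₁)) (hψ₁ : ψ₁ 1 = 1)
    (ψ₂ : CompletelyPositiveMap C.Alg (H₂ →L[ℂ] H₂)) (hψ₂ : ψ₂ 1 = 1) :
    ∃ ψ : CompletelyPositiveMap (B.tensor C).Alg (HilbertTensor H₁ H₂ →L[ℂ] HilbertTensor H₁ H₂),
      ∀ x y, ψ (kron x y) = tensorOp (ψ₁ x) (ψ₂ y) := by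
  have h₁ : CPDom (repLin B.rep) ψ₁.toLinearMap :=
    CompletelyPositiveMap.cpDom ψ₁ B.rep rep_injective (idRep H₁)
  have h₂ : CPDom (repLin C.rep) ψ₂.toLinearMap :=
    CompletelyPositiveMap.cpDom ψ₂ C.rep rep_injective (idRep H₂)
  have h := cpDom_rep_kron.trans (h₁.tensor h₂)
  have hn : ∀ w, ‖repLin (B.tensor C).rep w‖ = ‖w‖ :=
    NonUnitalStarAlgHom.norm_map (B.tensor C).rep rep_injective
  have hu : repLin (B.tensor C).rep (kronLin ((1 : B.Alg) ⊗ₜ[ℂ] (1 : C.Alg))) = 1 := by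
    rw [kronLin_tmul, kron_one_one, repLin_apply, map_one]
  have hα : tensorLin ψ₁.toLinearMap ψ₂.toLinearMap (1 ⊗ₜ 1) = 1 :=
    (congrArg₂ tensorOp hψ₁ hψ₂).trans tensorOp_one
  obtain ⟨Ψ, hΨ, hcp⟩ := h.exists_extension kronLin_surjective.denseRange hn hu hα
  exact ⟨CPDom.toCP (B.tensor C).rep (σ := idRep _) (idRep_injective _) hcp,
    fun x y => hΨ (x ⊗ₜ y)⟩

end Tensor

/-! ### Exponentials in C⋆-algebras. -/

section Exp

variable {A : Type*} [CStarAlgebra A]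

lemma exp_add_of_commute {x y : A} (h : Commute x y) :
    NormedSpace.exp (x + y) = NormedSpace.exp x * NormedSpace.exp y := by
  let _ := NormedAlgebra.restrictScalars ℚ ℂ A
  exact NormedSpace.exp_add_of_commute h

lemma exp_half_mul_self (x : A) :
    NormedSpace.exp ((1 / 2 : ℂ) • x) * NormedSpace.exp ((1 / 2 : ℂ) • x) = NormedSpace.exp x := by
  rw [← exp_add_of_commute (Commute.refl _), ← add_smul]
  norm_num

lemma isSelfAdjoint_exp_half {x : A} (hx : IsSelfAdjoint x) :
    IsSelfAdjoint (NormedSpace.exp ((1 / 2 : ℂ) • x)) := by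
  refine IsSelfAdjoint.exp ?_
  rw [isSelfAdjoint_iff, star_smul, hx.star_eq]
  norm_num

lemma norm_exp_le [Nontrivial A] (x : A) : ‖NormedSpace.exp x‖ ≤ Real.exp ‖x‖ := by
  rw [NormedSpace.exp_eq_tsum ℂ]
  have hs : HasSum (fun n : ℕ => (n.factorial⁻¹ : ℝ) • ‖x‖ ^ n) (Real.exp ‖x‖) := by
    rw [Real.exp_eq_exp_ℝ]
    exact NormedSpace.exp_series_hasSum_exp' (𝕂 := ℝ) ‖x‖
  refine tsum_of_norm_bounded hs fun n => ?_
  rw [norm_smul, norm_inv, smul_eq_mul]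
  have : ‖((n.factorial : ℕ) : ℂ)‖ = (n.factorial : ℝ) := by simp
  rw [this]
  gcongr
  exact norm_pow_le x n

end Exp

/-! ### Traces of exponentials. -/

namespace FinDimData

variable {B C : FinDimData}

lemma tr_star_mul_self (x : B.Alg) :
    B.tr (star x * x) = ((∑ i, ∑ j, ∑ k, ‖x i k j‖ ^ 2 : ℝ) : ℂ) := by
  rw [tr]
  push_cast
  refine Finset.sum_congr rfl fun i _ => Finset.sum_congr rfl fun j _ => ?_
  rw [Pi.mul_apply, CStarMatrix.mul_apply]
  refine Finset.sum_congr rfl fun k _ => ?_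
  rw [Pi.star_apply, CStarMatrix.star_apply]
  exact Complex.conj_mul' _

/-- Since exp x is the square of the self-adjoint element exp (x/2), its trace is a sum of squared
moduli, so it is real and nonnegative. -/
lemma tr_exp_eq {x : B.Alg} (hx : IsSelfAdjoint x) : B.tr (NormedSpace.exp x)
    = ((∑ i, ∑ j, ∑ k, ‖(NormedSpace.exp ((1 / 2 : ℂ) • x) : B.Alg) i k j‖ ^ 2 : ℝ) : ℂ) := by
  rw [← tr_star_mul_self, (isSelfAdjoint_exp_half hx).star_eq, exp_half_mul_self]

lemma tr_exp_eq_re {x : B.Alg} (hx : IsSelfAdjoint x) :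
    B.tr (NormedSpace.exp x) = (((B.tr (NormedSpace.exp x)).re : ℝ) : ℂ) := by
  rw [tr_exp_eq hx, Complex.ofReal_re]

lemma tr_exp_re_nonneg {x : B.Alg} (hx : IsSelfAdjoint x) :
    0 ≤ (B.tr (NormedSpace.exp x)).re := by
  rw [tr_exp_eq hx, Complex.ofReal_re]
  positivity

lemma norm_entry_le (x : B.Alg) (i : B.ι) (p q : B.n i) : ‖x i p q‖ ≤ ‖x‖ :=
  CStarMatrix.norm_entry_le_norm.trans (norm_le_pi_norm x i)

/-- Cauchy–Schwarz on a diagonal entry of exp(-x/2) exp(x/2) = 1 gives 1 ≤ exp(-x)ⱼⱼ exp(x)ⱼⱼ. The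
first factor is at most e^‖x‖ and the second at most the trace. -/
lemma exp_neg_norm_le_tr_exp [Nontrivial B.Alg] {x : B.Alg} (hx : IsSelfAdjoint x) :
    Real.exp (-‖x‖) ≤ (B.tr (NormedSpace.exp x)).re := by
  obtain ⟨i, j⟩ : Nonempty (Σ i, B.n i) := by
    by_contra h
    rw [not_nonempty_iff] at h
    refine not_subsingleton B.Alg ⟨fun x y => ?_⟩
    ext i p
    exact (h.false ⟨i, p⟩).elim
  set Q : B.Alg := NormedSpace.exp ((1 / 2 : ℂ) • x) with hQ
  set R : B.Alg := NormedSpace.exp ((1 / 2 : ℂ) • (-x)) with hR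
  have hRs : star R = R := (isSelfAdjoint_exp_half hx.neg).star_eq
  have hRQ : R * Q = 1 := by
    have hc : Commute ((1 / 2 : ℂ) • (-x)) ((1 / 2 : ℂ) • x) :=
      ((Commute.refl x).neg_left.smul_left _).smul_right _
    refine (exp_add_of_commute hc).symm.trans ?_
    rw [smul_neg, neg_add_cancel, NormedSpace.exp_zero]
  have h1 : ∑ k, R i j k * Q i k j = 1 := by
    have := congrArg (fun y : B.Alg => y i j j) hRQ
    simp only [Pi.mul_apply, CStarMatrix.mul_apply, Pi.one_apply, CStarMatrix.one_apply_eq] at this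
    exact this
  have h2 : ∑ k, ‖R i j k‖ ^ 2 ≤ Real.exp ‖x‖ := by
    have h3 : (NormedSpace.exp (-x) : B.Alg) i j j = ((∑ k, ‖R i j k‖ ^ 2 : ℝ) : ℂ) := by
      rw [← exp_half_mul_self, ← hR]
      nth_rw 2 [← hRs]
      rw [Pi.mul_apply, CStarMatrix.mul_apply]
      push_cast
      refine Finset.sum_congr rfl fun k _ => ?_
      rw [Pi.star_apply, CStarMatrix.star_apply]
      exact Complex.mul_conj' _
    have h4 := (norm_entry_le (NormedSpace.exp (-x)) i j j).trans (norm_exp_le (-x))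
    rw [h3, norm_neg, Complex.norm_real, Real.norm_of_nonneg (by positivity)] at h4
    exact h4
  have h5 : ∑ k, ‖Q i k j‖ ^ 2 ≤ (B.tr (NormedSpace.exp x)).re := by
    rw [tr_exp_eq hx, Complex.ofReal_re]
    calc ∑ k, ‖Q i k j‖ ^ 2 ≤ ∑ j, ∑ k, ‖Q i k j‖ ^ 2 :=
          Finset.single_le_sum (f := fun j => ∑ k, ‖Q i k j‖ ^ 2)
            (fun _ _ => by positivity) (Finset.mem_univ j)
      _ ≤ _ := Finset.single_le_sum (f := fun i => ∑ j, ∑ k, ‖Q i k j‖ ^ 2)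
            (fun _ _ => by positivity) (Finset.mem_univ i)
  have h6 : (1 : ℝ) ≤ ∑ k, ‖R i j k‖ * ‖Q i k j‖ := by
    calc (1 : ℝ) = ‖∑ k, R i j k * Q i k j‖ := by rw [h1, norm_one]
      _ ≤ ∑ k, ‖R i j k * Q i k j‖ := norm_sum_le _ _
      _ = _ := by simp
  have h7 := Finset.sum_mul_sq_le_sq_mul_sq Finset.univ (fun k => ‖R i j k‖) (fun k => ‖Q i k j‖)
  have h8 : (1 : ℝ) ≤ Real.exp ‖x‖ * (B.tr (NormedSpace.exp x)).re := by
    calc (1 : ℝ) ≤ (∑ k, ‖R i j k‖ * ‖Q i k j‖) ^ 2 := by nlinarith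
      _ ≤ _ := h7
      _ ≤ _ := mul_le_mul h2 h5 (by positivity) (Real.exp_pos _).le
  rw [Real.exp_neg, inv_le_iff_one_le_mul₀ (Real.exp_pos _)]
  linarith

lemma kron_mul (x x' : B.Alg) (y y' : C.Alg) :
    kron (x * x') (y * y') = kron x y * kron x' y' := by
  refine tensor_alg_ext fun i j p p' q q' => ?_
  change (∑ r, x i p r * x' i r p') * (∑ s, y j q s * y' j s q')
    = ∑ k : B.n i × C.n j, (x i p k.1 * y j q k.2) * (x' i k.1 p' * y' j k.2 q')
  rw [Finset.sum_mul_sum, Fintype.sum_prod_type]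
  refine Finset.sum_congr rfl fun r _ => Finset.sum_congr rfl fun s _ => ?_
  exact mul_mul_mul_comm _ _ _ _

lemma kron_star (x : B.Alg) (y : C.Alg) : kron (star x) (star y) = star (kron x y) := by
  refine tensor_alg_ext fun i j p p' q q' => ?_
  exact (map_mul (starRingEnd ℂ) _ _).symm

/-- The embedding of the first tensor factor. -/
noncomputable def kronLeft (B C : FinDimData) : B.Alg →⋆ₐ[ℂ] (B.tensor C).Alg where
  toFun x := kron x 1
  map_one' := kron_one_one
  map_mul' x y := by rw [← kron_mul, one_mul]
  map_zero' := tensor_alg_ext fun _ _ _ _ _ _ => zero_mul _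
  map_add' x y := tensor_alg_ext fun _ _ _ _ _ _ => add_mul _ _ _
  commutes' c := by
    rw [Algebra.algebraMap_eq_smul_one, Algebra.algebraMap_eq_smul_one, ← kron_one_one]
    exact tensor_alg_ext fun _ _ _ _ _ _ => mul_assoc _ _ _
  map_star' x := by rw [← kron_star, star_one]

/-- The embedding of the second tensor factor. -/
noncomputable def kronRight (B C : FinDimData) : C.Alg →⋆ₐ[ℂ] (B.tensor C).Alg where
  toFun x := kron 1 x
  map_one' := kron_one_one
  map_mul' x y := by rw [← kron_mul, one_mul]
  map_zero' := tensor_alg_ext fun _ _ _ _ _ _ => mul_zero _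
  map_add' x y := tensor_alg_ext fun _ _ _ _ _ _ => mul_add _ _ _
  commutes' c := by
    rw [Algebra.algebraMap_eq_smul_one, Algebra.algebraMap_eq_smul_one, ← kron_one_one]
    exact tensor_alg_ext fun _ _ _ _ _ _ => mul_left_comm _ _ _
  map_star' x := by rw [← kron_star, star_one]

lemma starAlgHom_exp {A A' : Type*} [CStarAlgebra A] [CStarAlgebra A'] (f : A →⋆ₐ[ℂ] A') (x : A) :
    f (NormedSpace.exp x) = NormedSpace.exp (f x) := by
  let _ := NormedAlgebra.restrictScalars ℚ ℂ A
  let _ := NormedAlgebra.restrictScalars ℚ ℂ A'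
  refine NormedSpace.map_exp f ?_ x
  exact AddMonoidHomClass.continuous_of_bound f 1 fun y => by
    rw [one_mul]
    exact NonUnitalStarAlgHom.norm_apply_le f y

lemma exp_kron_add (x : B.Alg) (y : C.Alg) : NormedSpace.exp (kron x 1 + kron 1 y)
    = kron (NormedSpace.exp x) (NormedSpace.exp y) := by
  have hc : Commute (kron x (1 : C.Alg)) (kron (1 : B.Alg) y) := by
    rw [Commute, SemiconjBy, ← kron_mul, ← kron_mul, one_mul, mul_one, one_mul, mul_one]
  rw [exp_add_of_commute hc]
  have h1 : NormedSpace.exp (kron x (1 : C.Alg)) = kron (NormedSpace.exp x) 1 :=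
    (starAlgHom_exp (kronLeft B C) x).symm
  have h2 : NormedSpace.exp (kron (1 : B.Alg) y) = kron 1 (NormedSpace.exp y) :=
    (starAlgHom_exp (kronRight B C) y).symm
  rw [h1, h2, ← kron_mul, one_mul, mul_one]

lemma tr_kron (x : B.Alg) (y : C.Alg) : (B.tensor C).tr (kron x y) = B.tr x * C.tr y := by
  rw [tr, tr, tr, Finset.sum_mul_sum]
  refine (Fintype.sum_prod_type _).trans ?_
  refine Finset.sum_congr rfl fun i _ => Finset.sum_congr rfl fun j _ => ?_
  rw [Finset.sum_mul_sum]
  exact Fintype.sum_prod_type _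

lemma ofReal_tr_exp_kron_add {x : B.Alg} (hx : IsSelfAdjoint x) (y : C.Alg) :
    ENNReal.ofReal ((B.tensor C).tr (NormedSpace.exp (kron x 1 + kron 1 y))).re
      = ENNReal.ofReal (B.tr (NormedSpace.exp x)).re
        * ENNReal.ofReal (C.tr (NormedSpace.exp y)).re := by
  rw [exp_kron_add, tr_kron, ← ENNReal.ofReal_mul (tr_exp_re_nonneg hx), tr_exp_eq_re hx,
    Complex.re_ofReal_mul, Complex.ofReal_re]

end FinDimData

/-! ### Orbit sums and lower bounds for the pressure. -/

section Orbit

variable {A H : Type*} [CStarAlgebra A] [PartialOrder A] [StarOrderedRing A]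
  [NormedAddCommGroup H] [InnerProductSpace ℂ H] [CompleteSpace H]
  {π : A →⋆ₐ[ℂ] (H →L[ℂ] H)} {θ : CompletelyPositiveMap A A}

lemma norm_iterate_le (hπ : Function.Injective π) (hθ : θ 1 = 1) (j : ℕ) (x : A) :
    ‖θ^[j] x‖ ≤ ‖x‖ := by
  induction j with
  | zero => exact le_rfl
  | succ j ih =>
    rw [Function.iterate_succ_apply']
    exact (CompletelyPositiveMap.norm_apply_le θ hθ hπ hπ _).trans ih

lemma iterate_sum {ι : Type*} (j : ℕ) (s : Finset ι) (f : ι → A) :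
    θ^[j] (∑ i ∈ s, f i) = ∑ i ∈ s, θ^[j] (f i) := by
  induction j with
  | zero => rfl
  | succ j ih => simp only [Function.iterate_succ_apply', ih, map_sum]

lemma isSelfAdjoint_iterate {x : A} (hx : IsSelfAdjoint x) (j : ℕ) : IsSelfAdjoint (θ^[j] x) := by
  induction j with
  | zero => exact hx
  | succ j ih =>
    rw [Function.iterate_succ_apply']
    exact ih.map θ

lemma isSelfAdjoint_orbitSum {x : A} (hx : IsSelfAdjoint x) (n : ℕ) :
    IsSelfAdjoint (orbitSum θ x n) :=
  isSelfAdjoint_sum _ fun j _ => isSelfAdjoint_iterate hx j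

lemma norm_orbitSum_le (hπ : Function.Injective π) (hθ : θ 1 = 1) (x : A) (n : ℕ) :
    ‖orbitSum θ x n‖ ≤ n * ‖x‖ := by
  refine (norm_sum_le_of_le _ fun j _ => norm_iterate_le hπ hθ j x).trans ?_
  rw [Finset.sum_const, Finset.card_range, nsmul_eq_mul]

lemma CPA.norm_le {S : Set A} {δ : ℝ} (hπ : Function.Injective π) (c : CPA π S δ) (x : A) :
    ‖c.φ x‖ ≤ ‖x‖ :=
  CompletelyPositiveMap.norm_apply_le c.φ c.φ_one hπ FinDimData.rep_injective x

lemma CPA.norm_comp_le {S : Set A} {δ : ℝ} (hπ : Function.Injective π) (c : CPA π S δ) (x : A) :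
    ‖c.ψ (c.φ x)‖ ≤ ‖x‖ :=
  (CompletelyPositiveMap.norm_apply_le c.ψ c.ψ_one FinDimData.rep_injective
    (idRep_injective H) _).trans (c.norm_le hπ x)

lemma CPA.nontrivial [Nontrivial A] {S : Set A} {δ : ℝ} (hπ : Function.Injective π)
    (c : CPA π S δ) : Nontrivial c.B.Alg := by
  by_contra h
  rw [not_nontrivial_iff_subsingleton] at h
  have h1 : (1 : H →L[ℂ] H) = 0 := by
    rw [← c.ψ_one, Subsingleton.elim (1 : c.B.Alg) 0, map_zero]
  exact one_ne_zero (hπ ((map_one π).trans (h1.trans (map_zero π).symm)))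

lemma ofReal_exp_le_partitionFunction [Nontrivial A] (hπ : Function.Injective π) (hθ : θ 1 = 1)
    {a : A} (ha : IsSelfAdjoint a) (Ω : Finset A) (δ : ℝ) (n : ℕ) :
    ENNReal.ofReal (Real.exp (-(n * ‖a‖))) ≤ partitionFunction θ π a Ω δ n := by
  refine le_iInf fun c => ENNReal.ofReal_le_ofReal ?_
  have := c.nontrivial hπ
  refine le_trans ?_ (FinDimData.exp_neg_norm_le_tr_exp ((isSelfAdjoint_orbitSum ha n).map c.φ))
  rw [Real.exp_le_exp, neg_le_neg_iff]
  exact (c.norm_le hπ _).trans (norm_orbitSum_le hπ hθ a n)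

lemma partitionFunction_ne_zero [Nontrivial A] (hπ : Function.Injective π) (hθ : θ 1 = 1)
    {a : A} (ha : IsSelfAdjoint a) (Ω : Finset A) (δ : ℝ) (n : ℕ) :
    partitionFunction θ π a Ω δ n ≠ 0 :=
  ((ENNReal.ofReal_pos.2 (Real.exp_pos _)).trans_le
    (ofReal_exp_le_partitionFunction hπ hθ ha Ω δ n)).ne'

/-- Contractivity gives ‖φ(a⁽ⁿ⁾)‖ ≤ n ‖a‖, so the partition function is at least e^(-n‖a‖) and the
limsup at least -‖a‖. -/
lemma pressureAt_ne_bot [Nontrivial A] (hπ : Function.Injective π) (hθ : θ 1 = 1)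
    {a : A} (ha : IsSelfAdjoint a) (Ω : Finset A) (δ : ℝ) : pressureAt θ π a Ω δ ≠ ⊥ := by
  have h : ((-‖a‖ : ℝ) : EReal) ≤ pressureAt θ π a Ω δ := by
    refine le_trans ?_ (liminf_le_limsup (f := atTop))
    refine le_liminf_of_le (h := ?_)
    filter_upwards [eventually_gt_atTop 0] with n hn
    have hn' : (0 : EReal) < (n : EReal) := by exact_mod_cast hn
    rw [EReal.le_div_iff_mul_le hn' (EReal.natCast_ne_top n)]
    refine le_trans ?_ (ENNReal.log_le_log (ofReal_exp_le_partitionFunction hπ hθ ha Ω δ n))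
    rw [ENNReal.log_ofReal_of_pos (Real.exp_pos _), Real.log_exp]
    refine le_of_eq ?_
    rw [← EReal.coe_natCast, ← EReal.coe_mul]
    congr 1
    ring
  exact ((EReal.bot_lt_coe _).trans_le h).ne'

lemma pressureAt_le_pressure {a : A} (Ω : Finset A) {δ : ℝ} (hδ : 0 < δ) :
    pressureAt θ π a Ω δ ≤ pressure θ π a :=
  le_iSup_of_le Ω (le_iSup_of_le δ (le_iSup_of_le hδ le_rfl))

/-- Over the zero algebra, the pressure is `-∞`. -/
lemma pressure_eq_bot [Subsingleton A] (a : A) : pressure θ π a = ⊥ := by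
  have hH : Subsingleton (H →L[ℂ] H) := by
    refine subsingleton_of_zero_eq_one ?_
    rw [← map_zero π, ← map_one π, Subsingleton.elim (0 : A) 1]
  -- The empty direct sum is the zero algebra, where 1 = 0 and the trace is an empty sum.
  let B : FinDimData := ⟨Empty, fun _ => Empty⟩
  have hB : Subsingleton B.Alg := ⟨fun x y => funext fun i => i.elim⟩
  have key (Ω : Finset A) (δ : ℝ) (hδ : 0 < δ) (n : ℕ) : partitionFunction θ π a Ω δ n = 0 := by
    let φ : CompletelyPositiveMap A B.Alg :=
      { toLinearMap := 0
        map_cstarMatrix_nonneg' := fun k M _ =>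
          le_of_eq (CStarMatrix.ext fun _ _ => Subsingleton.elim _ _) }
    let ψ : CompletelyPositiveMap B.Alg (H →L[ℂ] H) :=
      { toLinearMap := 0
        map_cstarMatrix_nonneg' := fun k M _ =>
          le_of_eq (CStarMatrix.ext fun _ _ => Subsingleton.elim _ _) }
    let c : CPA π (orbitSet θ Ω n) δ :=
      { B := B
        φ := φ
        ψ := ψ
        φ_one := Subsingleton.elim _ _
        ψ_one := Subsingleton.elim _ _
        approx := fun x _ => by rwa [Subsingleton.elim (ψ (φ x) - π x) 0, norm_zero] }
    refine le_antisymm ((iInf_le _ c).trans (le_of_eq ?_)) zero_le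
    change ENNReal.ofReal (∑ i : Empty, _ : ℂ).re = 0
    simp
  refine le_bot_iff.1 (iSup_le fun Ω => iSup_le fun δ => iSup_le fun hδ => ?_)
  refine limsup_le_of_le (h := ?_)
  -- For n = 0 the quotient ⊥ / 0 would be 0 instead of ⊥.
  filter_upwards [eventually_gt_atTop 0] with n hn
  rw [key Ω δ hδ n, ENNReal.log_zero,
    EReal.bot_div_of_pos_ne_top (by exact_mod_cast hn) (EReal.natCast_ne_top n)]

end Orbit

/-! ### Subadditivity of the pressure. -/

section TensorPressure

open MinTensor FinDimData

variable {A₁ A₂ H₁ H₂ K₁ K₂ K : Type*}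
  [CStarAlgebra A₁] [PartialOrder A₁] [StarOrderedRing A₁]
  [CStarAlgebra A₂] [PartialOrder A₂] [StarOrderedRing A₂]
  [NormedAddCommGroup H₁] [InnerProductSpace ℂ H₁] [CompleteSpace H₁]
  [NormedAddCommGroup H₂] [InnerProductSpace ℂ H₂] [CompleteSpace H₂]
  [NormedAddCommGroup K₁] [InnerProductSpace ℂ K₁] [CompleteSpace K₁]
  [NormedAddCommGroup K₂] [InnerProductSpace ℂ K₂] [CompleteSpace K₂]
  [NormedAddCommGroup K] [InnerProductSpace ℂ K] [CompleteSpace K]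
  {π₁ : A₁ →⋆ₐ[ℂ] (H₁ →L[ℂ] H₁)} {π₂ : A₂ →⋆ₐ[ℂ] (H₂ →L[ℂ] H₂)}
  {ρ₁ : A₁ →⋆ₐ[ℂ] (K₁ →L[ℂ] K₁)} {ρ₂ : A₂ →⋆ₐ[ℂ] (K₂ →L[ℂ] K₂)}
  {ρ : MinTensor π₁ π₂ →⋆ₐ[ℂ] (K →L[ℂ] K)}
  {θ₁ : CompletelyPositiveMap A₁ A₁} {θ₂ : CompletelyPositiveMap A₂ A₂}
  {θ : CompletelyPositiveMap (MinTensor π₁ π₂) (MinTensor π₁ π₂)}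

lemma iterate_tmul (hθ : ∀ x y, θ (tmul π₁ π₂ x y) = tmul π₁ π₂ (θ₁ x) (θ₂ y)) (j : ℕ)
    (x : A₁) (y : A₂) : θ^[j] (tmul π₁ π₂ x y) = tmul π₁ π₂ (θ₁^[j] x) (θ₂^[j] y) := by
  induction j with
  | zero => rfl
  | succ j ih => rw [Function.iterate_succ_apply', ih, hθ, Function.iterate_succ_apply',
      Function.iterate_succ_apply']

lemma orbitSum_tmul_add (hθ₁ : θ₁ 1 = 1) (hθ₂ : θ₂ 1 = 1)
    (hθ : ∀ x y, θ (tmul π₁ π₂ x y) = tmul π₁ π₂ (θ₁ x) (θ₂ y)) (a₁ : A₁) (a₂ : A₂) (n : ℕ) :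
    orbitSum θ (tmul π₁ π₂ a₁ 1 + tmul π₁ π₂ 1 a₂) n
      = tmul π₁ π₂ (orbitSum θ₁ a₁ n) 1 + tmul π₁ π₂ 1 (orbitSum θ₂ a₂ n) := by
  simp only [orbitSum, ← ofTensor_tmul, TensorProduct.sum_tmul, TensorProduct.tmul_sum, map_sum]
  rw [← Finset.sum_add_distrib]
  refine Finset.sum_congr rfl fun j _ => ?_
  simp only [ofTensor_tmul]
  rw [iterate_map_add, iterate_tmul hθ, iterate_tmul hθ, Function.iterate_fixed hθ₁,
    Function.iterate_fixed hθ₂]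

omit [CompleteSpace H₁] [CompleteSpace H₂] in
lemma norm_tensorOp_sub_le (S S' : H₁ →L[ℂ] H₁) (T T' : H₂ →L[ℂ] H₂) :
    ‖tensorOp S T - tensorOp S' T'‖ ≤ ‖S - S'‖ * ‖T‖ + ‖S'‖ * ‖T - T'‖ := by
  have h : tensorOp S T - tensorOp S' T' = tensorOp (S - S') T + tensorOp S' (T - T') := by
    have h1 := tensorOp_add_left (S - S') S' T
    have h2 := tensorOp_add_right S' (T - T') T'
    rw [sub_add_cancel] at h1 h2
    rw [h1, h2]
    abel
  rw [h]
  exact (norm_add_le _ _).trans (add_le_add (norm_tensorOp_le _ _) (norm_tensorOp_le _ _))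

omit [PartialOrder A₁] [StarOrderedRing A₁] [PartialOrder A₂] [StarOrderedRing A₂] in
lemma exists_sum_tmul_near (z : MinTensor π₁ π₂) {ε : ℝ} (hε : 0 < ε) :
    ∃ S : Finset (A₁ × A₂), ‖z - ∑ s ∈ S, tmul π₁ π₂ s.1 s.2‖ < ε := by
  obtain ⟨w, hw⟩ := Metric.denseRange_iff.1 (denseRange_ofTensor π₁ π₂) z ε hε
  obtain ⟨S, rfl⟩ := TensorProduct.exists_finset w
  refine ⟨S, ?_⟩
  rwa [dist_eq_norm, map_sum] at hw

/-- The tensor product of two completely positive approximations. -/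
lemma CPA.exists_tensor (hπ₁ : Function.Injective π₁) (hπ₂ : Function.Injective π₂)
    {S₁ : Set A₁} {S₂ : Set A₂} {δ : ℝ} (c₁ : CPA π₁ S₁ δ) (c₂ : CPA π₂ S₂ δ) :
    ∃ (φ : CompletelyPositiveMap (MinTensor π₁ π₂) (c₁.B.tensor c₂.B).Alg)
      (ψ : CompletelyPositiveMap (c₁.B.tensor c₂.B).Alg
        (HilbertTensor H₁ H₂ →L[ℂ] HilbertTensor H₁ H₂)),
      φ 1 = 1 ∧ ψ 1 = 1 ∧ (∀ x y, φ (tmul π₁ π₂ x y) = kron (c₁.φ x) (c₂.φ y)) ∧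
      ∀ x ∈ S₁, ∀ y ∈ S₂, ‖ψ (φ (tmul π₁ π₂ x y)) - incl π₁ π₂ (tmul π₁ π₂ x y)‖
        ≤ δ * (‖x‖ + ‖y‖) := by
  obtain ⟨φ, hφ⟩ := exists_cp_to_tensor hπ₁ hπ₂ c₁.φ c₁.φ_one c₂.φ c₂.φ_one
  obtain ⟨ψ, hψ⟩ := exists_cp_from_tensor c₁.ψ c₁.ψ_one c₂.ψ c₂.ψ_one
  refine ⟨φ, ψ, ?_, ?_, hφ, fun x hx y hy => ?_⟩
  · rw [← tmul_one_one, hφ, c₁.φ_one, c₂.φ_one, kron_one_one]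
  · rw [← kron_one_one, hψ, c₁.ψ_one, c₂.ψ_one, tensorOp_one]
  · rw [hφ, hψ, incl_tmul]
    refine (norm_tensorOp_sub_le _ _ _ _).trans ?_
    have h1 := mul_le_mul (c₁.approx x hx).le (c₂.norm_comp_le hπ₂ y) (norm_nonneg _)
      ((norm_nonneg _).trans (c₁.approx x hx).le)
    have h2 := mul_le_mul (NonUnitalStarAlgHom.norm_apply_le π₁ x) (c₂.approx y hy).le
      (norm_nonneg _) (norm_nonneg _)
    linarith

/-- Elements of Ω are close to finite sums of elementary tensors; the legs of these tensors form Ω₁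
and Ω₂. Since θ is contractive and acts legwise, the same sums approximate the whole orbit, with
errors uniform in n. -/
lemma exists_cpa_tensor (hπ₁ : Function.Injective π₁) (hπ₂ : Function.Injective π₂)
    (hρ₁ : Function.Injective ρ₁) (hρ₂ : Function.Injective ρ₂)
    (hθ₁ : θ 1 = 1) (hθ : ∀ x y, θ (tmul π₁ π₂ x y) = tmul π₁ π₂ (θ₁ x) (θ₂ y))
    (hn₁ : ∀ j x, ‖θ₁^[j] x‖ ≤ ‖x‖) (hn₂ : ∀ j x, ‖θ₂^[j] x‖ ≤ ‖x‖)
    (Ω : Finset (MinTensor π₁ π₂)) {δ : ℝ} (hδ : 0 < δ) :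
    ∃ (Ω₁ : Finset A₁) (Ω₂ : Finset A₂) (δ' : ℝ), 0 < δ' ∧
      ∀ (n : ℕ) (c₁ : CPA ρ₁ (orbitSet θ₁ Ω₁ n) δ') (c₂ : CPA ρ₂ (orbitSet θ₂ Ω₂ n) δ'),
        ∃ c : CPA ρ (orbitSet θ Ω n) δ, ∀ x y, IsSelfAdjoint x →
          ENNReal.ofReal (c.B.tr (NormedSpace.exp
            (c.φ (tmul π₁ π₂ x 1 + tmul π₁ π₂ 1 y)))).re
          = ENNReal.ofReal (c₁.B.tr (NormedSpace.exp (c₁.φ x))).re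
            * ENNReal.ofReal (c₂.B.tr (NormedSpace.exp (c₂.φ y))).re := by
  classical
  have hε : 0 < δ / 4 := by positivity
  choose S hS using fun z : MinTensor π₁ π₂ => exists_sum_tmul_near z hε
  set T : Finset (A₁ × A₂) := Ω.biUnion S with hT
  set M : ℝ := ∑ s ∈ T, (‖s.1‖ + ‖s.2‖) with hM
  have hM0 : 0 ≤ M := Finset.sum_nonneg fun _ _ => by positivity
  -- M bounds the total weight ‖x‖ + ‖y‖ of the tensors in use, so their joint error is at most δ/4;
  -- the 1 covers M = 0. The remainder of norm below δ/4 costs at most 2 · δ/4, and the total 3δ/4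
  -- is below δ.
  refine ⟨T.image Prod.fst, T.image Prod.snd, δ / 4 / (1 + M), by positivity, fun n c₁ c₂ => ?_⟩
  obtain ⟨φ, ψ, hφ1, hψ1, hφ, hψφ⟩ :=
    CPA.exists_tensor hπ₁ hπ₂ (c₁.transfer hρ₁ π₁) (c₂.transfer hρ₂ π₂)
  let D : MinTensor π₁ π₂ →+ (HilbertTensor H₁ H₂ →L[ℂ] HilbertTensor H₁ H₂) :=
    { toFun x := ψ (φ x) - incl π₁ π₂ x
      map_zero' := by simp
      map_add' x y := by
        rw [map_add, map_add, map_add]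
        abel }
  have hD (x) : ‖D x‖ ≤ 2 * ‖x‖ := by
    refine (norm_sub_le _ _).trans ?_
    have h1 := CompletelyPositiveMap.norm_apply_le ψ hψ1 rep_injective (idRep_injective _) (φ x)
    have h2 := CompletelyPositiveMap.norm_apply_le φ hφ1 (incl_injective π₁ π₂) rep_injective x
    have h3 := norm_incl π₁ π₂ x
    linarith
  let c : CPA (incl π₁ π₂) (orbitSet θ Ω n) δ :=
    { B := _, φ := φ, ψ := ψ, φ_one := hφ1, ψ_one := hψ1
      approx := by
        rintro _ ⟨j, hj, z, hz, rfl⟩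
        set w := ∑ s ∈ S z, tmul π₁ π₂ s.1 s.2 with hw
        have hsub : S z ⊆ T := Finset.subset_biUnion_of_mem S hz
        have h1 : ‖D (θ^[j] (z - w))‖ ≤ 2 * (δ / 4) :=
          (hD _).trans (mul_le_mul_of_nonneg_left
            ((norm_iterate_le (incl_injective π₁ π₂) hθ₁ j _).trans (hS z).le) zero_le_two)
        have h2 : ‖D (θ^[j] w)‖ ≤ δ / 4 := by
          rw [hw, iterate_sum, map_sum]
          have h3 : ∀ s ∈ S z, ‖D (θ^[j] (tmul π₁ π₂ s.1 s.2))‖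
              ≤ δ / 4 / (1 + M) * (‖s.1‖ + ‖s.2‖) := fun s hs => by
            rw [iterate_tmul hθ]
            refine (hψφ _ ⟨j, hj, s.1, Finset.mem_image_of_mem _ (hsub hs), rfl⟩ _
              ⟨j, hj, s.2, Finset.mem_image_of_mem _ (hsub hs), rfl⟩).trans ?_
            gcongr
            · exact hn₁ j s.1
            · exact hn₂ j s.2
          refine (norm_sum_le_of_le _ h3).trans ?_
          rw [← Finset.mul_sum, div_mul_eq_mul_div, div_le_iff₀ (by positivity)]
          gcongr
          have : ∑ s ∈ S z, (‖s.1‖ + ‖s.2‖) ≤ M :=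
            Finset.sum_le_sum_of_subset_of_nonneg hsub fun _ _ _ => by positivity
          linarith
        have h4 : D (θ^[j] z) = D (θ^[j] (z - w)) + D (θ^[j] w) := by
          rw [← map_add, ← iterate_map_add, sub_add_cancel]
        change ‖D (θ^[j] z)‖ < δ
        rw [h4]
        refine (norm_add_le _ _).trans_lt ?_
        linarith }
  -- The transfers alter only ψ, so the trace is computed with the original `c₁.φ` and `c₂.φ`.
  refine ⟨c.transfer (incl_injective π₁ π₂) ρ, fun x y hx => ?_⟩
  have h : φ (tmul π₁ π₂ x 1 + tmul π₁ π₂ 1 y) = kron (c₁.φ x) 1 + kron 1 (c₂.φ y) := by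
    rw [map_add, hφ, hφ, CPA.φ_one, CPA.φ_one]
    rfl
  change ENNReal.ofReal ((c₁.B.tensor c₂.B).tr (NormedSpace.exp
    (φ (tmul π₁ π₂ x 1 + tmul π₁ π₂ 1 y)))).re = _
  rw [h]
  exact ofReal_tr_exp_kron_add (hx.map c₁.φ) _

theorem pressure_tmul_add_le (hπ₁ : Function.Injective π₁) (hπ₂ : Function.Injective π₂)
    (hρ₁ : Function.Injective ρ₁) (hρ₂ : Function.Injective ρ₂)
    (hθ₁ : θ₁ 1 = 1) (hθ₂ : θ₂ 1 = 1)
    (hθ : ∀ x y, θ (tmul π₁ π₂ x y) = tmul π₁ π₂ (θ₁ x) (θ₂ y))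
    {a₁ : A₁} (ha₁ : IsSelfAdjoint a₁) {a₂ : A₂} (ha₂ : IsSelfAdjoint a₂) :
    pressure θ ρ (tmul π₁ π₂ a₁ 1 + tmul π₁ π₂ 1 a₂) ≤ pressure θ₁ ρ₁ a₁ + pressure θ₂ ρ₂ a₂ := by
  have hθ1 : θ 1 = 1 := by rw [← tmul_one_one, hθ, hθ₁, hθ₂]
  rcases subsingleton_or_nontrivial A₁ with h₁ | h₁
  · have : Subsingleton (MinTensor π₁ π₂) := by
      refine subsingleton_of_zero_eq_one ?_
      rw [← tmul_one_one, Subsingleton.elim (1 : A₁) 0, ← ofTensor_tmul, TensorProduct.zero_tmul,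
        map_zero]
    rw [pressure_eq_bot]
    exact bot_le
  rcases subsingleton_or_nontrivial A₂ with h₂ | h₂
  · have : Subsingleton (MinTensor π₁ π₂) := by
      refine subsingleton_of_zero_eq_one ?_
      rw [← tmul_one_one, Subsingleton.elim (1 : A₂) 0, ← ofTensor_tmul, TensorProduct.tmul_zero,
        map_zero]
    rw [pressure_eq_bot]
    exact bot_le
  refine iSup_le fun Ω => iSup_le fun δ => iSup_le fun hδ => ?_
  obtain ⟨Ω₁, Ω₂, δ', hδ', hc⟩ := exists_cpa_tensor (ρ := ρ) hπ₁ hπ₂ hρ₁ hρ₂ hθ1 hθ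
    (norm_iterate_le hπ₁ hθ₁) (norm_iterate_le hπ₂ hθ₂) Ω hδ
  have hZ (n : ℕ) : partitionFunction θ ρ (tmul π₁ π₂ a₁ 1 + tmul π₁ π₂ 1 a₂) Ω δ n
      ≤ partitionFunction θ₁ ρ₁ a₁ Ω₁ δ' n * partitionFunction θ₂ ρ₂ a₂ Ω₂ δ' n := by
    have hZ₁ := partitionFunction_ne_zero hρ₁ hθ₁ ha₁ Ω₁ δ' n
    have hZ₂ := partitionFunction_ne_zero hρ₂ hθ₂ ha₂ Ω₂ δ' n
    -- A product of infima is the infimum of the products unless 0 · ∞ intervenes. An infimum over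
    -- no approximations is ∞, so it is the nonvanishing of both partition functions that excludes
    -- this.
    rw [partitionFunction.eq_def θ₁, ENNReal.iInf_mul' (fun _ h => (hZ₁ h).elim)
      (fun h => (hZ₂ h).elim)]
    refine le_iInf fun c₁ => ?_
    rw [partitionFunction.eq_def θ₂, ENNReal.mul_iInf' (fun _ h => (hZ₂ h).elim) (fun h => ?_)]
    · refine le_iInf fun c₂ => ?_
      obtain ⟨c, hc⟩ := hc n c₁ c₂
      rw [← hc _ _ (isSelfAdjoint_orbitSum ha₁ n), ← orbitSum_tmul_add hθ₁ hθ₂ hθ]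
      exact iInf_le _ c
    · exact (hZ₁ (le_antisymm ((iInf_le _ c₁).trans h.le) zero_le)).elim
  refine le_trans ?_ (add_le_add (pressureAt_le_pressure Ω₁ hδ') (pressureAt_le_pressure Ω₂ hδ'))
  -- Subadditivity of limsup in the extended reals needs ⊥ + ⊤ excluded; both summands are above ⊥.
  refine le_trans (limsup_le_limsup (.of_forall fun n => ?_)) (EReal.limsup_add_le
    (.inl (pressureAt_ne_bot hρ₁ hθ₁ ha₁ Ω₁ δ')) (.inr (pressureAt_ne_bot hρ₂ hθ₂ ha₂ Ω₂ δ')))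
  have hn : (0 : EReal) ≤ (n : EReal) := by positivity
  rw [Pi.add_apply, ← EReal.add_div_of_nonneg_right hn, ← ENNReal.log_mul_add]
  exact EReal.div_le_div_right_of_nonneg hn (ENNReal.log_le_log (hZ n))

end TensorPressure

end NCPressure

theorem proposition3p5 {A₁ A₂ H₁ H₂ K₁ K₂ K : Type*}
    [CStarAlgebra A₁] [PartialOrder A₁] [StarOrderedRing A₁]
    [CStarAlgebra A₂] [PartialOrder A₂] [StarOrderedRing A₂]
    [NormedAddCommGroup H₁] [InnerProductSpace ℂ H₁] [CompleteSpace H₁]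
    [NormedAddCommGroup H₂] [InnerProductSpace ℂ H₂] [CompleteSpace H₂]
    [NormedAddCommGroup K₁] [InnerProductSpace ℂ K₁] [CompleteSpace K₁]
    [NormedAddCommGroup K₂] [InnerProductSpace ℂ K₂] [CompleteSpace K₂]
    [NormedAddCommGroup K] [InnerProductSpace ℂ K] [CompleteSpace K]
    (hA₁ : NCPressure.IsExact A₁) (hA₂ : NCPressure.IsExact A₂)
    -- faithful unital representations which realize the minimal tensor product
    (π₁ : A₁ →⋆ₐ[ℂ] (H₁ →L[ℂ] H₁)) (hπ₁ : Function.Injective π₁)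
    (π₂ : A₂ →⋆ₐ[ℂ] (H₂ →L[ℂ] H₂)) (hπ₂ : Function.Injective π₂)
    -- arbitrary faithful unital representations through which the pressures are computed
    (ρ₁ : A₁ →⋆ₐ[ℂ] (K₁ →L[ℂ] K₁)) (hρ₁ : Function.Injective ρ₁)
    (ρ₂ : A₂ →⋆ₐ[ℂ] (K₂ →L[ℂ] K₂)) (hρ₂ : Function.Injective ρ₂)
    (ρ : NCPressure.MinTensor π₁ π₂ →⋆ₐ[ℂ] (K →L[ℂ] K)) (hρ : Function.Injective ρ)
    (θ₁ : CompletelyPositiveMap A₁ A₁) (hθ₁ : θ₁ 1 = 1)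
    (θ₂ : CompletelyPositiveMap A₂ A₂) (hθ₂ : θ₂ 1 = 1)
    (a₁ : A₁) (ha₁ : IsSelfAdjoint a₁) (a₂ : A₂) (ha₂ : IsSelfAdjoint a₂) :
    -- there is exactly one completely positive extension `θ` of `θ₁ ⊗ θ₂`, it is unital, and
    ∃ θ : CompletelyPositiveMap (NCPressure.MinTensor π₁ π₂) (NCPressure.MinTensor π₁ π₂),
      (∀ x y, θ (NCPressure.MinTensor.tmul π₁ π₂ x y) =
        NCPressure.MinTensor.tmul π₁ π₂ (θ₁ x) (θ₂ y)) ∧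
      (∀ θ' : CompletelyPositiveMap (NCPressure.MinTensor π₁ π₂) (NCPressure.MinTensor π₁ π₂),
        (∀ x y, θ' (NCPressure.MinTensor.tmul π₁ π₂ x y) =
          NCPressure.MinTensor.tmul π₁ π₂ (θ₁ x) (θ₂ y)) → θ' = θ) ∧
      θ 1 = 1 ∧
      NCPressure.pressure θ ρ
          (NCPressure.MinTensor.tmul π₁ π₂ a₁ 1 + NCPressure.MinTensor.tmul π₁ π₂ 1 a₂) ≤
        NCPressure.pressure θ₁ ρ₁ a₁ + NCPressure.pressure θ₂ ρ₂ a₂ := by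
  obtain ⟨θ, hθ⟩ := NCPressure.exists_minTensor_cp hπ₁ hπ₂ θ₁ hθ₁ θ₂ hθ₂
  refine ⟨θ, hθ, fun θ' hθ' => ?_, ?_, ?_⟩
  · exact NCPressure.minTensor_cp_ext fun x y => (hθ' x y).trans (hθ x y).symm
  · rw [← NCPressure.MinTensor.tmul_one_one, hθ, hθ₁, hθ₂]
  · exact NCPressure.pressure_tmul_add_le hπ₁ hπ₂ hρ₁ hρ₂ hθ₁ hθ₂ hθ ha₁ ha₂
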